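/- A \emph{signed, colored graph of type $(n,N)$} is a triple $\mathcal G=(V,\sigma,E)$ consisting of a finite vertex set $V$, a signature function $\sigma:V\to\{\pm1\}^{N-1}$, and, for each $1<i<n$, a collection $E_i$ of unordered pairs of distinct vertices. It is \emph{connected} if $V\neq\emptyset$ and any two vertices are joined by a path of edges from $\bigcup_i E_i$. For $m\le n$, $M\le N$ its \emph{$(m,M)$-restriction} has the same vertices, the signatures truncated to their first $M-1$ entries, and only the edges $E_2\cup\dots\cup E_{m-1}$. Consider the following axioms (indices of signatures range over $1,\dots,N-1$; a condition involving an index out of this range is void). (ax1) For $w\in V$ and $1<i<n$, $\sigma(w)_{i-1}=-\sigma(w)_i$ if and only if there is $x\in V$ with $\{w,x\}\in E_i$; moreover $x$ is unique when it exists. (ax2) If $\{w,x\}\in E_i$, then $\sigma(w)_j=-\sigma(x)_j$ for $j=i-1,i$, and $\sigma(w)_h=\sigma(x)_h$ for $h<i-2$ and $h>i+1$. (ax3) If $\{w,x\}\in E_i$ and $\sigma(w)_{i-2}=-\sigma(x)_{i-2}$, then $\sigma(w)_{i-2}=-\sigma(w)_{i-1}$; if $\{w,x\}\in E_i$ and $\sigma(w)_{i+1}=-\sigma(x)_{i+1}$,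 then $\sigma(w)_{i+1}=-\sigma(w)_i$. (ax4) For $2<i<n$, every connected component of $(V,E_{i-1}\cup E_i)$ is, as an edge-colored graph, one of: a point; a path $a,b,c$ with $ab\in E_{i-1}$, $bc\in E_i$; two vertices joined by both an $(i-1)$-edge and an $i$-edge. For $3<i<n$, every connected component of $(V,E_{i-2}\cup E_{i-1}\cup E_i)$ is, as an edge-colored graph, one of: a point; a path on four vertices whose consecutive edges have colors $i-2,i-1,i$; the graph on $a,b,c,d,e$ with $E_{i-2}=\{ab,cd\}$, $E_{i-1}=\{ab,de\}$, $E_i=\{bc,de\}$; the graph on $u,v,w,x,y,z$ with $E_{i-2}=\{vw,xy\}$, $E_{i-1}=\{uv,yz\}$, $E_i=\{vx,wy\}$. (ax5) If $\{w,x\}\in E_i$ and $\{x,y\}\in E_j$ with $|i-j|\ge3$, then there is $v\in V$ with $\{w,v\}\in E_j$ and $\{v,y\}\in E_i$. A \emph{morphism} $(V,\sigma,E)\to(W,\tau,F)$ of signed, colored graphs of type $(n,N)$ satisfying (ax1) is a map $\phi:V\to W$ with $\sigma(v)_i=\tau(\phi(v))_i$ for all $v\in V$, $1\le i<N$, and $\{\phi(u),\phi(v)\}\in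 F_i$ whenever $\{u,v\}\in E_i$, $1<i<n$. It is an \emph{isomorphism} if it is bijective on vertices. For a partition $\lambda$ of $n$, the \emph{standard dual equivalence graph} $\mathcal G_\lambda$ of type $(n,n)$ has as vertices the standard Young tableaux $T$ of shape $\lambda$ (in French convention: rows are stacked upward, with the longest at the bottom). The content reading word $w_T$ lists the entries of $T$ in increasing order of content (column minus row), each diagonal from southwest to northeast. One puts $\sigma(T)_i=+1$ if $i$ is to the left of $i+1$ in $w_T$, and $-1$ otherwise. Distinct $T,U$ are joined by an $i$-edge, $1<i<n$, if $w_U=d_i(w_T)$, where $d_i$ fixes a permutation $w$ in which $i$ lies between $i-1$ and $i+1$, and otherwise interchanges $i$ with whichever of $i\pm1$ is further away from $i$ in $w$. \textbf{Theorem.} Let $n\ge0$ and let $\mathcal G$ be a connected signed, colored graph of type $(n+1,n+1)$ satisfying axioms 1--5, such that each connected component of its $(n,n)$-restriction is isomorphic to $\mathcal G_\mu$ for some partition $\mu$ of $n$. Then there is a partition $\lambda$ of $n+1$ and a surjective morphism from $\mathcal G$ onto $\mathcal G_\lambda$; moreover $\lambda$ is unique, in the sense that if there is any morphism from $\mathcal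 G$ to $\mathcal G_\mu$, $\mu$ a partition of $n+1$, then $\mu=\lambda$. -/

import Mathlib

/-! ### Signed, colored graphs -/

/-- A signed, colored graph of type `(n, N)` on the finite vertex set `V`. The signature of a
vertex is indexed by `1 ≤ j < N`, and for every color `1 < i < n` the collection `E i` of
unordered pairs of distinct vertices is recorded as a simple graph. -/
structure SignedColoredGraph (n N : ℕ) (V : Type*) [Finite V] where
  /-- the signature function `V → {±1}^(N-1)` -/
  sign : V → Set.Ico 1 N → ℤˣ
  /-- the `i`-colored edges, `1 < i < n` -/
  E : Set.Ioo 1 n → SimpleGraph V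

namespace SignedColoredGraph

variable {n N : ℕ} {V W : Type*} [Finite V] [Finite W]

/-- The graph obtained by forgetting signatures and colors. -/
def underlying (G : SignedColoredGraph n N V) : SimpleGraph V := ⨆ i, G.E i

/-- Connectedness (in particular, there is at least one vertex). -/
def IsConnected (G : SignedColoredGraph n N V) : Prop := G.underlying.Connected

/-- The `(m, M)`-restriction: truncate the signatures and keep only the edges of color `< m`. -/
def restrict (G : SignedColoredGraph n N V) {m M : ℕ} (hm : m ≤ n) (hM : M ≤ N) :
    SignedColoredGraph m M V where
  sign v j := G.sign v ⟨j.1, j.2.1, j.2.2.trans_le hM⟩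
  E i := G.E ⟨i.1, i.2.1, i.2.2.trans_le hm⟩

/-- The signed, colored graph induced on a set of vertices. -/
def induce (G : SignedColoredGraph n N V) (S : Set V) : SignedColoredGraph n N S where
  sign v := G.sign v.1
  E i := (G.E i).induce S

/-- Axiom 1. -/
def Axiom1 (G : SignedColoredGraph n N V) : Prop :=
  ∀ (i : Set.Ioo 1 n) (w : V),
    (∀ a b : Set.Ico 1 N, (a : ℕ) + 1 = i → (b : ℕ) = i →
      (G.sign w a = -G.sign w b ↔ ∃ x, (G.E i).Adj w x)) ∧
    (∀ x y, (G.E i).Adj w x → (G.E i).Adj w y → x = y)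

/-- Axiom 2. -/
def Axiom2 (G : SignedColoredGraph n N V) : Prop :=
  ∀ (i : Set.Ioo 1 n) (w x : V), (G.E i).Adj w x → ∀ j : Set.Ico 1 N,
    ((j : ℕ) + 1 = i ∨ (j : ℕ) = i → G.sign w j = -G.sign x j) ∧
    ((j : ℕ) + 2 < i ∨ (i : ℕ) + 1 < j → G.sign w j = G.sign x j)

/-- Axiom 3. Here `a, b, c, d` stand for the indices `i - 2, i - 1, i, i + 1`. -/
def Axiom3 (G : SignedColoredGraph n N V) : Prop :=
  ∀ (i : Set.Ioo 1 n) (w x : V), (G.E i).Adj w x →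
    (∀ a b : Set.Ico 1 N, (a : ℕ) + 2 = i → (b : ℕ) + 1 = i →
      G.sign w a = -G.sign x a → G.sign w a = -G.sign w b) ∧
    (∀ c d : Set.Ico 1 N, (c : ℕ) = i → (d : ℕ) = i + 1 →
      G.sign w d = -G.sign x d → G.sign w d = -G.sign w c)

/-- Every connected component of the graph with edges `F 0 ∪ ⋯ ∪ F (k - 1)`, with its edges
colored by `Fin k`, is isomorphic as an edge-colored graph to a member of the list `L`. -/
def ComponentsAppearIn {k : ℕ} (F : Fin k → SimpleGraph V)
    (L : List (Σ m : ℕ, Fin k → SimpleGraph (Fin m))) : Prop :=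
  ∀ C : (⨆ j, F j).ConnectedComponent, ∃ P ∈ L, ∃ e : C.supp ≃ Fin P.1,
    ∀ (j : Fin k) (u v : C.supp), (F j).Adj u v ↔ (P.2 j).Adj (e u) (e v)

/-- The allowed components for two consecutive colors `i - 1, i` (here called `0, 1`): a point,
a path with two edges of colors `i - 1, i`, and a double edge. -/
def twoColorComponents : List (Σ m : ℕ, Fin 2 → SimpleGraph (Fin m)) :=
  [⟨1, ![⊥, ⊥]⟩,
   ⟨3, ![.fromEdgeSet {s(0, 1)}, .fromEdgeSet {s(1, 2)}]⟩,
   ⟨2, ![.fromEdgeSet {s(0, 1)}, .fromEdgeSet {s(0, 1)}]⟩]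

/-- The allowed components for three consecutive colors `i - 2, i - 1, i` (here called
`0, 1, 2`), with `1`, `4`, `5` and `6` vertices. -/
def threeColorComponents : List (Σ m : ℕ, Fin 3 → SimpleGraph (Fin m)) :=
  [⟨1, ![⊥, ⊥, ⊥]⟩,
   ⟨4, ![.fromEdgeSet {s(0, 1)}, .fromEdgeSet {s(1, 2)}, .fromEdgeSet {s(2, 3)}]⟩,
   ⟨5, ![.fromEdgeSet {s(0, 1), s(2, 3)}, .fromEdgeSet {s(0, 1), s(3, 4)},
         .fromEdgeSet {s(1, 2), s(3, 4)}]⟩,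
   ⟨6, ![.fromEdgeSet {s(1, 2), s(3, 4)}, .fromEdgeSet {s(0, 1), s(4, 5)},
         .fromEdgeSet {s(1, 3), s(2, 4)}]⟩]

/-- Axiom 4. -/
def Axiom4 (G : SignedColoredGraph n N V) : Prop :=
  (∀ i j : Set.Ioo 1 n, (i : ℕ) + 1 = j →
    ComponentsAppearIn ![G.E i, G.E j] twoColorComponents) ∧
  (∀ i j k : Set.Ioo 1 n, (i : ℕ) + 1 = j → (j : ℕ) + 1 = k →
    ComponentsAppearIn ![G.E i, G.E j, G.E k] threeColorComponents)

/-- Axiom 5. The condition on the colors says `|i - j| ≥ 3`. -/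
def Axiom5 (G : SignedColoredGraph n N V) : Prop :=
  ∀ (i j : Set.Ioo 1 n), (i : ℕ) + 3 ≤ j ∨ (j : ℕ) + 3 ≤ i →
    ∀ w x y : V, (G.E i).Adj w x → (G.E j).Adj x y →
      ∃ v, (G.E j).Adj w v ∧ (G.E i).Adj v y

/-- Morphisms preserve signatures and colored edges. -/
def IsMorphism (G : SignedColoredGraph n N V) (H : SignedColoredGraph n N W) (φ : V → W) : Prop :=
  (∀ v i, G.sign v i = H.sign (φ v) i) ∧
  (∀ i u v, (G.E i).Adj u v → (H.E i).Adj (φ u) (φ v))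

/-- An isomorphism is a morphism that is a bijection on vertices (this is used for graphs
satisfying axiom 1 only). -/
def IsIsomorphic (G : SignedColoredGraph n N V) (H : SignedColoredGraph n N W) : Prop :=
  ∃ φ : V → W, G.IsMorphism H φ ∧ Function.Bijective φ

end SignedColoredGraph

/-! ### Permutations and elementary dual equivalences -/

/-- The elementary dual equivalence `d_i` on a word `w` in which each of `i - 1, i, i + 1`
occurs once: if `i` lies between `i - 1` and `i + 1`, nothing happens; otherwise `i` is
interchanged with whichever of `i ± 1` is further away from it. -/
def elementaryDualEquivalence (i : ℕ) (w : List ℕ) : List ℕ :=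
  let p := w.idxOf (i - 1)
  let q := w.idxOf i
  let r := w.idxOf (i + 1)
  if (p < q ∧ q < r) ∨ (r < q ∧ q < p) then w
  else if Nat.dist q p < Nat.dist q r then w.map (Equiv.swap i (i + 1))
  else w.map (Equiv.swap i (i - 1))

/-! ### Standard tableaux -/

/-- The Young diagram of a partition. Cells are pairs (row, column), counted from `0`, the
longest row coming first. -/
def Nat.Partition.diagram {n : ℕ} (p : n.Partition) : YoungDiagram :=
  YoungDiagram.ofRowLens (p.parts.sort (· ≥ ·)) (Multiset.pairwise_sort _ _).sortedGE

/-- Standard Young tableaux of shape `p`: semistandard tableaux that are bijections from the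
diagram onto `{1, …, n}`. -/
def StandardTableau {n : ℕ} (p : n.Partition) : Type :=
  {T : SemistandardYoungTableau p.diagram //
    Set.BijOn (fun c : ℕ × ℕ => T c.1 c.2) p.diagram.cells (Set.Icc 1 n)}

/-- The order in which the content reading word visits cells `(row, column)`: increasing
content `column - row`, and along each diagonal from southwest to northeast (row `0` is the
southernmost row). -/
def contentLE (c d : ℕ × ℕ) : Prop :=
  toLex ((c.2 : ℤ) - c.1, c.1) ≤ toLex ((d.2 : ℤ) - d.1, d.1)

instance : DecidableRel contentLE := fun c d => by unfold contentLE; infer_instance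

instance : IsTrans (ℕ × ℕ) contentLE := ⟨fun _ _ _ h h' => le_trans h h'⟩

instance : Std.Total contentLE := ⟨fun _ _ => le_total _ _⟩

instance : Std.Antisymm contentLE := ⟨fun c d h h' => by
  have h2 := Prod.ext_iff.1 (toLex.injective (le_antisymm h h'))
  simp only at h2
  exact Prod.ext h2.2 (by omega)⟩

namespace StandardTableau

variable {n : ℕ} {p : n.Partition}

instance : Finite (StandardTableau p) := by
  let f : StandardTableau p → (p.diagram.cells → Set.Icc 1 n) := fun T c =>
    ⟨T.1 c.1.1 c.1.2, T.2.mapsTo c.2⟩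
  refine Finite.of_injective f fun T U h => Subtype.ext (SemistandardYoungTableau.ext fun i j => ?_)
  by_cases hc : (i, j) ∈ p.diagram
  · exact congrArg Subtype.val (congrFun h ⟨(i, j), (YoungDiagram.mem_cells _).2 hc⟩)
  · rw [T.1.zeros hc, U.1.zeros hc]

/-- The content reading word. -/
def word (T : StandardTableau p) : List ℕ :=
  (p.diagram.cells.sort contentLE).map fun c => T.1 c.1 c.2

/-- The descent signature: `+1` at `i` if `i` appears to the left of `i + 1` in the content
reading word, and `-1` otherwise. -/
def descentSignature (T : StandardTableau p) (i : Set.Ico 1 n) : ℤˣ :=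
  if T.word.idxOf (i : ℕ) < T.word.idxOf ((i : ℕ) + 1) then 1 else -1

end StandardTableau

/-- The standard dual equivalence graph `G_λ` of type `(n, n)`, for `λ` a partition of `n`: two
distinct standard tableaux of shape `λ` are joined by an `i`-edge if their content reading words
differ by the elementary dual equivalence `d_i`. -/
def standardDualEquivalenceGraph {n : ℕ} (p : n.Partition) :
    SignedColoredGraph n n (StandardTableau p) where
  sign T := T.descentSignature
  E i := SimpleGraph.fromRel fun T U => U.word = elementaryDualEquivalence i T.word

/-! ### Content vectors

A standard tableau is encoded by the list of the contents of its cells, the cell with the largest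
entry coming first. Shapes are encoded by their sets of beads on `ℤ`: adding a cell of content `k`
moves a bead from `k` to `k + 1`. -/

/-! Recorded by its contents, a standard tableau involves only comparisons of integers: a sign
compares the contents of two consecutive entries, and `d_i` those of three. Two facts about shapes
carry the proof. Between two addable cells there is a removable one (`exists_removable_between`), so
an addable cell is determined by the removable cells to its left. And the tableaux of one shape are
connected by dual equivalences (`reflTransGen_linked`). Together they give rigidity
(`eq_of_bisimulation`): a tableau is determined by its signature together with the signatures
reached from it along dual equivalences.

In a component of the restriction, a copy of some `G_μ`, the sign at `n` depends only on the cell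
containing `n` (axiom 2) and is monotone in the content of that cell (axiom 3). Hence a single
addable cell, given to `n + 1`, explains this sign on the whole component (`exists_extension`).
Every vertex now carries a content vector of length `n + 1` that has the right signature and is
compatible with the colors below `n`.

The heart is that the edges of color `n`, which may join different components, are dual equivalences
too (`dualEquiv_of_adj`). Axiom 5 transports such an edge along all dual equivalences of the `n - 2`
smallest entries. By rigidity its two ends agree on these entries, which may then be rearranged at
will. Placing a suitably chosen corner among the largest of them makes axiom 4 exclude every outcome
but the correct exchange among the top three contents.

Since dual equivalences preserve the shape and `G` is connected, all labels have one shape `λ`. By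
axiom 1 dual equivalences lift to edges, so connectedness of `G_λ` gives surjectivity. Rigidity,
applied to the labelling and to any other morphism, gives uniqueness. -/

namespace ContentVector

/-- `b` lies strictly between `a` and `c`. -/
def Between (a b c : ℤ) : Prop := a < b ∧ b < c ∨ c < b ∧ b < a

/-- Exchange the contents of the positions `k` and `k + 1`. -/
def moveBead (k : ℤ) (S : Set ℤ) : Set ℤ :=
  {x | (x = k ∧ k + 1 ∈ S) ∨ (x = k + 1 ∧ k ∈ S) ∨ (x ≠ k ∧ x ≠ k + 1 ∧ x ∈ S)}

theorem mem_moveBead {k x : ℤ} {S : Set ℤ} : x ∈ moveBead k S ↔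
    (x = k ∧ k + 1 ∈ S) ∨ (x = k + 1 ∧ k ∈ S) ∨ (x ≠ k ∧ x ≠ k + 1 ∧ x ∈ S) := Iff.rfl

/-- The bead set of the shape of a content vector. -/
def shape : List ℤ → Set ℤ
  | [] => Set.Iic 0
  | k :: l => moveBead k (shape l)

/-- A cell of content `k` can be added. -/
def Addable (S : Set ℤ) (k : ℤ) : Prop := k ∈ S ∧ k + 1 ∉ S

/-- A cell of content `k` can be removed. -/
def Removable (S : Set ℤ) (k : ℤ) : Prop := k ∉ S ∧ k + 1 ∈ S

/-- Content vectors of standard tableaux. -/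
def IsStd : List ℤ → Prop
  | [] => True
  | k :: l => Addable (shape l) k ∧ IsStd l

/-- Two distinct content vectors are related by the `i`-th elementary dual equivalence. -/
def DualEquiv (i : ℕ) : List ℤ → List ℤ → Prop
  | [], _ => False
  | c :: l, l' => if l.length = i then ∃ a b t, l = b :: a :: t ∧
      (Between a c b ∧ l' = c :: a :: b :: t ∨ Between b a c ∧ l' = b :: c :: a :: t)
    else ∃ m, l' = c :: m ∧ DualEquiv i l m

/-- The `j`-th entry of the descent signature. -/
def sgn (j : ℕ) : List ℤ → ℤˣ
  | [] => 1
  | b :: l => if l.length = j then (if l.headD 0 < b then 1 else -1) else sgn j l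

/-! ### Corners -/

theorem exists_removable_of_lt {S : Set ℤ} {x y : ℤ} (hx : x ∉ S) (hy : y ∈ S) (h : x < y) :
    ∃ c, Removable S c ∧ x ≤ c ∧ c < y := by
  by_contra! H
  have key : ∀ z, x ≤ z → z ≤ y → z ∉ S := by
    intro z hz
    induction z, hz using Int.leInduction with
    | base => exact fun _ => hx
    | succ z hz ih =>
      intro hzy hm
      exact absurd (H z ⟨ih (by omega), hm⟩ hz) (by omega)
  exact key y h.le le_rfl hy

/-- If `k < l`, the position `k + 1` is empty and `l` is occupied, so somewhere between them an
empty position is followed by a bead. All test cells used later come from here. -/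
theorem exists_removable_between {S : Set ℤ} {k l : ℤ} (hk : Addable S k) (hl : Addable S l)
    (h : k ≠ l) : ∃ c, Removable S c ∧ Between k c l := by
  rcases lt_or_gt_of_ne h with h | h
  · have : k + 1 ≠ l := fun e => hk.2 (e ▸ hl.1)
    obtain ⟨c, hc, h1, h2⟩ := exists_removable_of_lt hk.2 hl.1 (by omega)
    exact ⟨c, hc, .inl ⟨by omega, by omega⟩⟩
  · have : l + 1 ≠ k := fun e => hl.2 (e ▸ hk.1)
    obtain ⟨c, hc, h1, h2⟩ := exists_removable_of_lt hl.2 hk.1 (by omega)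
    exact ⟨c, hc, .inr ⟨by omega, by omega⟩⟩

theorem Addable.removable_moveBead {S : Set ℤ} {k : ℤ} (h : Addable S k) :
    Removable (moveBead k S) k := by
  grind [Addable, Removable, mem_moveBead]

theorem Removable.of_moveBead {S : Set ℤ} {k c : ℤ} (hk : Addable S k)
    (hc : Removable (moveBead k S) c) (hne : c ≠ k) :
    Removable S c ∧ (c + 1 < k ∨ k + 1 < c) := by
  have h1 : k + 1 ≠ c := by grind [Addable, Removable, mem_moveBead]
  have h2 : c + 1 ≠ k := by grind [Addable, Removable, mem_moveBead]
  refine ⟨?_, by omega⟩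
  grind [Addable, Removable, mem_moveBead]

theorem moveBead_comm {S : Set ℤ} {k l : ℤ} (h : k + 1 < l ∨ l + 1 < k) :
    moveBead k (moveBead l S) = moveBead l (moveBead k S) := by
  ext x
  simp only [mem_moveBead]
  have h1 : k ≠ l := by omega
  have h2 : k + 1 ≠ l := by omega
  have h3 : k ≠ l + 1 := by omega
  grind

theorem addable_moveBead_iff {S : Set ℤ} {k l : ℤ} (h : k + 1 < l ∨ l + 1 < k) :
    Addable (moveBead k S) l ↔ Addable S l := by
  have h1 : k ≠ l := by omega
  have h2 : k + 1 ≠ l := by omega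
  have h3 : k ≠ l + 1 := by omega
  grind [Addable, mem_moveBead]

theorem addable_moveBead_ne {S : Set ℤ} {k l : ℤ} (hk : Addable S k)
    (hl : Addable (moveBead k S) l) : l ≠ k := by
  grind [Addable, mem_moveBead]

/-- Consecutive cells that are not adjacent may be added in either order. -/
theorem IsStd.swap {k l : ℤ} {t : List ℤ} (h : k + 1 < l ∨ l + 1 < k)
    (hs : IsStd (k :: l :: t)) : IsStd (l :: k :: t) :=
  ⟨(addable_moveBead_iff h).2 hs.2.1, (addable_moveBead_iff h.symm).1 hs.1, hs.2.2⟩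

theorem shape_swap {k l : ℤ} {t : List ℤ} (h : k + 1 < l ∨ l + 1 < k) :
    shape (k :: l :: t) = shape (l :: k :: t) := moveBead_comm h

theorem IsStd.removable {k : ℤ} {t : List ℤ} (h : IsStd (k :: t)) :
    Removable (shape (k :: t)) k := h.1.removable_moveBead

theorem shape_cons_injective {k : ℤ} {t t' : List ℤ} (h : shape (k :: t) = shape (k :: t')) :
    shape t = shape t' := by
  ext x
  have h1 := Set.ext_iff.1 h
  simp only [shape, mem_moveBead] at h1
  have := h1 x
  have := h1 k
  have := h1 (k + 1)
  grind

/-- Any corner can hold the largest entry. A corner other than the last added cell was a corner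
already before, and its content is not adjacent to that of the last cell. By induction it can be
filled last in the smaller shape, and then the two top entries are exchanged. -/
theorem exists_isStd_cons {l : List ℤ} {c : ℤ} (hl : IsStd l) (hc : Removable (shape l) c) :
    ∃ t, IsStd (c :: t) ∧ shape (c :: t) = shape l ∧ (c :: t).length = l.length := by
  induction l generalizing c with
  | nil => simp [Removable, shape] at hc; omega
  | cons k l ih =>
    by_cases hck : c = k
    · exact ⟨l, hck ▸ hl, by rw [hck], rfl⟩
    obtain ⟨h1, h2⟩ := hc.of_moveBead hl.1 hck
    obtain ⟨t, ht, hs, hlen⟩ := ih hl.2 h1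
    have hkt : IsStd (k :: c :: t) := ⟨hs ▸ hl.1, ht⟩
    refine ⟨k :: t, hkt.swap h2.symm, ?_, by simpa using hlen⟩
    rw [← shape_swap h2.symm, shape, hs, shape]

/-- Once two corners are removed, both are addable, so a further corner `c` lies between them. With
`c` filled just before the two, exchanging them is an elementary dual equivalence. -/
theorem exists_isStd_cons_cons_cons {t : List ℤ} {k l : ℤ} (ht : IsStd (k :: t))
    (hl : Removable (shape (k :: t)) l) (h : l ≠ k) :
    ∃ c s, Between k c l ∧ IsStd (k :: l :: c :: s) ∧ IsStd (l :: k :: c :: s) ∧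
      shape (l :: c :: s) = shape t ∧ (l :: c :: s).length = t.length ∧
      shape (l :: k :: c :: s) = shape (k :: t) := by
  obtain ⟨h1, h2⟩ := hl.of_moveBead ht.1 h
  obtain ⟨s, hs, hsh, hlen⟩ := exists_isStd_cons ht.2 h1
  have hk : IsStd (k :: l :: s) := ⟨hsh ▸ ht.1, hs⟩
  have hl' := hk.swap h2.symm
  obtain ⟨c, hc, hb⟩ := exists_removable_between hl'.2.1 hs.1 h.symm
  obtain ⟨u, hu, hush, hulen⟩ := exists_isStd_cons hs.2 hc
  have e : shape (l :: c :: u) = shape t := by rw [← hsh, shape, hush, shape]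
  refine ⟨c, u, hb, ⟨?_, ?_, hu⟩, ⟨?_, ?_, hu⟩, e, ?_, ?_⟩
  · rw [e]; exact ht.1
  · rw [hush]; exact hs.1
  · rw [shape, hush]; exact hl'.1
  · rw [hush]; exact hl'.2.1
  · rw [← hlen]; simpa using hulen
  · rw [← shape_swap h2.symm, shape, e, shape]

/-! ### Dual equivalences of content vectors -/

theorem dualEquiv_cons {i : ℕ} {x : ℤ} {l l' : List ℤ} (h : l.length ≠ i) :
    DualEquiv i (x :: l) l' ↔ ∃ m, l' = x :: m ∧ DualEquiv i l m := by
  rw [DualEquiv, if_neg h]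

theorem dualEquiv_top {i : ℕ} {a b c : ℤ} {t l' : List ℤ} (h : t.length + 2 = i) :
    DualEquiv i (c :: b :: a :: t) l' ↔
      Between a c b ∧ l' = c :: a :: b :: t ∨ Between b a c ∧ l' = b :: c :: a :: t := by
  rw [DualEquiv, if_pos (by simpa using h)]
  constructor
  · rintro ⟨a', b', t', e, h⟩
    simp only [List.cons.injEq] at e
    obtain ⟨rfl, rfl, rfl⟩ := e
    exact h
  · exact fun h => ⟨a, b, t, rfl, h⟩

theorem DualEquiv.two_le_lt {i : ℕ} {l l' : List ℤ} (h : DualEquiv i l l') :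
    2 ≤ i ∧ i < l.length := by
  induction l generalizing l' with
  | nil => exact h.elim
  | cons c l ih =>
    by_cases hl : l.length = i
    · rw [DualEquiv, if_pos hl] at h
      obtain ⟨a, b, t, rfl, -⟩ := h
      simp at hl ⊢
      omega
    · obtain ⟨m, -, hm⟩ := (dualEquiv_cons hl).1 h
      have := ih hm
      simp
      omega

theorem DualEquiv.cons {i : ℕ} {l l' : List ℤ} (x : ℤ) (h : DualEquiv i l l') :
    DualEquiv i (x :: l) (x :: l') :=
  (dualEquiv_cons h.two_le_lt.2.ne').2 ⟨l', rfl, h⟩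

theorem DualEquiv.perm {i : ℕ} {l l' : List ℤ} (h : DualEquiv i l l') : l.Perm l' := by
  induction l generalizing l' with
  | nil => exact h.elim
  | cons c l ih =>
    by_cases hl : l.length = i
    · rw [DualEquiv, if_pos hl] at h
      obtain ⟨a, b, t, rfl, ⟨-, rfl⟩ | ⟨-, rfl⟩⟩ := h
      · exact (List.Perm.swap ..).cons _
      · exact List.Perm.swap ..
    · obtain ⟨m, rfl, hm⟩ := (dualEquiv_cons hl).1 h
      exact (ih hm).cons _

theorem DualEquiv.unique {i : ℕ} {l l₁ l₂ : List ℤ} (h₁ : DualEquiv i l l₁)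
    (h₂ : DualEquiv i l l₂) : l₁ = l₂ := by
  induction l generalizing l₁ l₂ with
  | nil => exact h₁.elim
  | cons c l ih =>
    by_cases hl : l.length = i
    · have hl' := h₁.two_le_lt.1
      obtain ⟨b, a, t, rfl⟩ : ∃ b a t, l = b :: a :: t := by
        match l, hl with
        | [], hl => simp at hl; omega
        | [_], hl => simp at hl; omega
        | b :: a :: t, _ => exact ⟨b, a, t, rfl⟩
      rw [dualEquiv_top (by simpa using hl)] at h₁ h₂
      unfold Between at h₁ h₂
      rcases h₁ with ⟨hb, rfl⟩ | ⟨hb, rfl⟩ <;> rcases h₂ with ⟨hb', rfl⟩ | ⟨hb', rfl⟩ <;>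
        first | rfl | (exfalso; omega)
    · obtain ⟨m, rfl, hm⟩ := (dualEquiv_cons hl).1 h₁
      obtain ⟨m', rfl, hm'⟩ := (dualEquiv_cons hl).1 h₂
      rw [ih hm hm']

theorem DualEquiv.shape_eq {i : ℕ} {l l' : List ℤ} (h : DualEquiv i l l') :
    shape l = shape l' := by
  induction l generalizing l' with
  | nil => exact h.elim
  | cons c l ih =>
    by_cases hl : l.length = i
    · rw [DualEquiv, if_pos hl] at h
      obtain ⟨a, b, t, rfl, ⟨hb, rfl⟩ | ⟨hb, rfl⟩⟩ := h
      · rw [shape, shape_swap (by unfold Between at hb; omega), ← shape]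
      · exact shape_swap (by unfold Between at hb; omega)
    · obtain ⟨m, rfl, hm⟩ := (dualEquiv_cons hl).1 h
      rw [shape, shape, ih hm]

theorem DualEquiv.symm {i : ℕ} {l l' : List ℤ}
    (h : DualEquiv i l l') : DualEquiv i l' l := by
  induction l generalizing l' with
  | nil => exact h.elim
  | cons c l ih =>
    by_cases hl : l.length = i
    · rw [DualEquiv, if_pos hl] at h
      obtain ⟨a, b, t, rfl, ⟨hb, rfl⟩ | ⟨hb, rfl⟩⟩ := h <;>
        simp only [List.length_cons] at hl <;> rw [dualEquiv_top hl]
      · exact .inl ⟨hb.symm, rfl⟩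
      · exact .inr ⟨hb.symm, rfl⟩
    · obtain ⟨m, rfl, hm⟩ := (dualEquiv_cons hl).1 h
      exact (ih hm).cons c

/-- Some dual equivalence relates two content vectors. -/
def Linked (l l' : List ℤ) : Prop := ∃ i, DualEquiv i l l'

theorem reflTransGen_linked_cons {l l' : List ℤ} (x : ℤ)
    (h : Relation.ReflTransGen Linked l l') :
    Relation.ReflTransGen Linked (x :: l) (x :: l') :=
  h.lift _ fun _ _ ⟨i, hi⟩ => ⟨i, hi.cons x⟩

/-- The standard dual equivalence graph of a shape is connected. -/
theorem reflTransGen_linked {l l' : List ℤ} (hl : IsStd l) (hl' : IsStd l')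
    (hlen : l.length = l'.length) (hs : shape l = shape l') :
    Relation.ReflTransGen Linked l l' := by
  obtain ⟨N, hN⟩ : ∃ N, l.length = N := ⟨_, rfl⟩
  induction N generalizing l l' with
  | zero => rw [List.length_eq_zero_iff.1 hN, List.length_eq_zero_iff.1 (hlen.symm.trans hN)]
  | succ N ih =>
    obtain ⟨k, t, rfl⟩ := List.exists_cons_of_length_eq_add_one hN
    obtain ⟨k', t', rfl⟩ := List.exists_cons_of_length_eq_add_one (hlen.symm.trans hN)
    simp only [List.length_cons, Nat.add_right_cancel_iff] at hN hlen
    by_cases hk : k' = k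
    · subst hk
      exact reflTransGen_linked_cons _ (ih hl.2 hl'.2 hlen (shape_cons_injective hs) hN)
    -- If the largest entries sit in different corners, induction inside each corner leads to
    -- tableaux that differ by one dual equivalence exchanging the two corners.
    · obtain ⟨c, s, hb, h1, h2, h3, h4, h5⟩ :=
        exists_isStd_cons_cons_cons hl (hs ▸ hl'.removable) hk
      have h6 : shape (k :: c :: s) = shape t' := shape_cons_injective (h5.trans hs)
      have h7 : (k :: c :: s).length = (k' :: c :: s).length := rfl
      have step : Linked (k :: k' :: c :: s) (k' :: k :: c :: s) :=
        ⟨_, (dualEquiv_top rfl).2 (.inr ⟨hb.symm, rfl⟩)⟩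
      have p1 := reflTransGen_linked_cons k (ih hl.2 h1.2 h4.symm h3.symm hN)
      have p2 := reflTransGen_linked_cons k'
        (ih h2.2 hl'.2 (by omega) h6 (by omega))
      exact (p1.tail step).trans p2

theorem DualEquiv.isStd {i : ℕ} {l l' : List ℤ} (h : DualEquiv i l l') (hl : IsStd l) :
    IsStd l' := by
  induction l generalizing l' with
  | nil => exact h.elim
  | cons c l ih =>
    by_cases hli : l.length = i
    · rw [DualEquiv, if_pos hli] at h
      obtain ⟨a, b, t, rfl, ⟨hb, rfl⟩ | ⟨hb, rfl⟩⟩ := h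
      · have h' : b + 1 < a ∨ a + 1 < b := by unfold Between at hb; omega
        refine ⟨?_, hl.2.swap h'⟩
        rw [← shape_swap h']
        exact hl.1
      · exact hl.swap (by unfold Between at hb; omega)
    · obtain ⟨m, rfl, hm⟩ := (dualEquiv_cons hli).1 h
      exact ⟨hm.shape_eq ▸ hl.1, ih hm hl.2⟩

/-! ### Signatures -/

theorem sgn_cons {j : ℕ} {b : ℤ} {l : List ℤ} (h : l.length ≠ j) : sgn j (b :: l) = sgn j l := by
  rw [sgn, if_neg h]

theorem sgn_top {j : ℕ} {a b : ℤ} {t : List ℤ} (h : t.length + 1 = j) :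
    sgn j (b :: a :: t) = if a < b then 1 else -1 := by
  rw [sgn, if_pos (by simpa using h), List.headD_cons]

theorem IsStd.ne {a b : ℤ} {t : List ℤ} (h : IsStd (b :: a :: t)) : b ≠ a :=
  addable_moveBead_ne h.2.1 h.1

/-- Between two additions on the diagonal `a`, position `a` must be refilled and `a + 1` vacated.
This takes two additions, of contents `a - 1` and `a + 1`, but only `b` is available. -/
theorem IsStd.ne' {a b c : ℤ} {t : List ℤ} (h : IsStd (c :: b :: a :: t)) : c ≠ a := by
  obtain ⟨h1, h2, h3, -⟩ := h
  simp only [shape] at h1 h2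
  have := addable_moveBead_ne h3 h2
  rintro rfl
  simp only [Addable, mem_moveBead] at h1 h2 h3
  grind

theorem exists_dualEquiv_top_iff {i : ℕ} {a b c : ℤ} {t : List ℤ} (h : t.length + 2 = i)
    (hs : IsStd (c :: b :: a :: t)) :
    (∃ l', DualEquiv i (c :: b :: a :: t) l') ↔ (a < b ∧ c < b ∨ b < a ∧ b < c) := by
  have h1 := hs.ne'
  simp only [dualEquiv_top h, Between]
  constructor
  · rintro ⟨l', h | h⟩ <;> omega
  · intro h
    by_cases h' : a < c ∧ c < b ∨ b < c ∧ c < a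
    · exact ⟨_, .inl ⟨h', rfl⟩⟩
    · exact ⟨_, .inr ⟨by omega, rfl⟩⟩

theorem exists_dualEquiv_cons_iff {i : ℕ} {x : ℤ} {l : List ℤ} (h : l.length ≠ i) :
    (∃ l', DualEquiv i (x :: l) l') ↔ ∃ l', DualEquiv i l l' := by
  simp [dualEquiv_cons h]

theorem sgn_eq_neg_iff {i : ℕ} {l : List ℤ} (hl : IsStd l) (h2 : 2 ≤ i) (hi : i < l.length) :
    sgn (i - 1) l = -sgn i l ↔ ∃ l', DualEquiv i l l' := by
  induction l with
  | nil => simp at hi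
  | cons c l ih =>
    by_cases hli : l.length = i
    · obtain ⟨b, a, t, rfl⟩ : ∃ b a t, l = b :: a :: t := by
        match l, hli with
        | [], hl => simp at hl; omega
        | [_], hl => simp at hl; omega
        | b :: a :: t, _ => exact ⟨b, a, t, rfl⟩
      simp only [List.length_cons] at hli
      rw [exists_dualEquiv_top_iff (by omega) hl, sgn_cons (by simp; omega), sgn_top (by omega),
        sgn_top (by simp; omega)]
      have := hl.ne
      have := hl.2.ne
      split_ifs <;> simp <;> omega
    · rw [exists_dualEquiv_cons_iff hli, sgn_cons hli, sgn_cons (by simp at hi; omega)]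
      exact ih hl.2 (by simp at hi; omega)

/-- Addable cells are told apart by the removable cells between them. -/
theorem Addable.eq_of_lt_iff_lt {S : Set ℤ} {k l : ℤ} (hk : Addable S k) (hl : Addable S l)
    (h : ∀ c, Removable S c → (c < k ↔ c < l)) : k = l := by
  by_contra hne
  obtain ⟨c, hc, hb⟩ := exists_removable_between hk hl hne
  have := h c hc
  unfold Between at hb
  omega

theorem exists_isStd_cons_reachable {t : List ℤ} (ht : IsStd t) {c : ℤ}
    (hc : Removable (shape t) c) :
    ∃ s, IsStd (c :: s) ∧ shape (c :: s) = shape t ∧ (c :: s).length = t.length ∧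
      Relation.ReflTransGen Linked t (c :: s) := by
  obtain ⟨s, h1, h2, h3⟩ := exists_isStd_cons ht hc
  exact ⟨s, h1, h2, h3, reflTransGen_linked ht h1 h3.symm h2.symm⟩

/-- Rigidity: a relation between content vectors of standard tableaux that is compatible with the
signatures and through which dual equivalences can be lifted is contained in equality. -/
theorem eq_of_bisimulation (N : ℕ) (R : List ℤ → List ℤ → Prop)
    (hR : ∀ l l', R l l' → IsStd l ∧ IsStd l' ∧ l.length = N ∧ l'.length = N ∧
      ∀ j, 1 ≤ j → j < N → sgn j l = sgn j l')
    (hstep : ∀ i l l' m, R l l' → DualEquiv i l m → ∃ m', DualEquiv i l' m' ∧ R m m')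
    {l l' : List ℤ} (h : R l l') : l = l' := by
  induction N generalizing R l l' with
  | zero =>
    obtain ⟨-, -, h1, h2, -⟩ := hR _ _ h
    rw [List.length_eq_zero_iff.1 h1, List.length_eq_zero_iff.1 h2]
  | succ N ih =>
    obtain ⟨hl, hl', h1, h2, -⟩ := hR _ _ h
    obtain ⟨k, t, rfl⟩ := List.exists_cons_of_length_eq_add_one h1
    obtain ⟨k', t', rfl⟩ := List.exists_cons_of_length_eq_add_one h2
    have hR' : ∀ s s', R (k :: s) (k' :: s') → IsStd s ∧ IsStd s' ∧ s.length = N ∧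
        s'.length = N ∧ ∀ j, 1 ≤ j → j < N → sgn j s = sgn j s' := by
      intro s s' hs
      obtain ⟨h1, h2, h3, h4, h5⟩ := hR _ _ hs
      simp only [List.length_cons, Nat.add_right_cancel_iff] at h3 h4
      refine ⟨h1.2, h2.2, h3, h4, fun j hj hjN => ?_⟩
      rw [← sgn_cons (b := k) (by omega), h5 j hj (by omega), sgn_cons (by omega)]
    have hstep' : ∀ i s s' m, R (k :: s) (k' :: s') → DualEquiv i s m →
        ∃ m', DualEquiv i s' m' ∧ R (k :: m) (k' :: m') := by
      intro i s s' m hs hm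
      obtain ⟨n, hn, hRn⟩ := hstep i _ _ _ hs (hm.cons k)
      have := (hR' _ _ hs).2.2
      have := hm.two_le_lt.2
      obtain ⟨m', rfl, hm'⟩ := (dualEquiv_cons (by omega)).1 hn
      exact ⟨m', hm', hRn⟩
    -- With both heads fixed, the relation on tails satisfies the same hypotheses: dual equivalences
    -- of the tails leave the heads alone.
    have key : ∀ {s s'}, R (k :: s) (k' :: s') → s = s' :=
      ih (fun s s' => R (k :: s) (k' :: s')) hR' hstep'
    obtain rfl := key h
    have reach : ∀ s, Relation.ReflTransGen Linked t s → R (k :: s) (k' :: s) := by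
      intro s hs
      induction hs with
      | refl => exact h
      | tail _ hm ih' =>
        obtain ⟨i, hi⟩ := hm
        obtain ⟨m', -, hm⟩ := hstep' i _ _ _ ih' hi
        obtain rfl := key hm
        exact hm
    congr 1
    -- The common tail may be replaced by any other of its shape, in particular by one with a
    -- prescribed corner `c` on top. The last sign then compares `c` with `k` on one side and with
    -- `k'` on the other.
    refine hl.1.eq_of_lt_iff_lt hl'.1 fun c hc => ?_
    obtain ⟨s, h3, h4, h5, h6⟩ := exists_isStd_cons_reachable hl.2 hc
    obtain ⟨-, -, h7, -, h8⟩ := hR _ _ (reach _ h6)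
    simp only [List.length_cons, Nat.add_right_cancel_iff] at h7
    have := h8 N (by omega) (by omega)
    rw [sgn_top h7, sgn_top h7] at this
    by_cases h9 : c < k <;> by_cases h10 : c < k'
    · exact iff_of_true h9 h10
    · rw [if_pos h9, if_neg h10] at this
      exact absurd this (by decide)
    · rw [if_neg h9, if_pos h10] at this
      exact absurd this (by decide)
    · exact iff_of_false h9 h10

/-! ### Extending a labelling by content vectors to the edges of the largest color -/

/-- A labelling of the vertices of a graph with colored edges by content vectors of length `n + 1`
that is compatible with the edges of color less than `n`, together with local conditions on the
edges of color `n`. -/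
structure IsLabelling {V : Type*} (n : ℕ) (adj : ℕ → V → V → Prop) (Φ : V → List ℤ) : Prop where
  symm : ∀ {i v x}, adj i v x → adj i x v
  std : ∀ v, IsStd (Φ v)
  length : ∀ v, (Φ v).length = n + 1
  exists_iff : ∀ {i} v, 1 < i → i ≤ n → ((∃ x, adj i v x) ↔ ∃ l, DualEquiv i (Φ v) l)
  dual : ∀ {i v x}, i < n → adj i v x → DualEquiv i (Φ v) (Φ x)
  sgn_neg : ∀ {v x}, adj n v x → sgn n (Φ v) = -sgn n (Φ x)
  sgn_eq : ∀ {v x j}, adj n v x → 1 ≤ j → j + 2 < n → sgn j (Φ v) = sgn j (Φ x)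
  comm : ∀ {i v w x}, i + 3 ≤ n → adj i v w → adj n w x → ∃ y, adj n v y ∧ adj i y x
  two : ∀ {v a x}, 3 ≤ n → adj (n - 1) v a → adj n v x →
    a = x ∨ (¬∃ y, adj n a y) ∧ ¬∃ y, adj (n - 1) x y
  two' : ∀ {v x}, 3 ≤ n → adj n v x → (∃ y, adj (n - 1) v y) ∨ ∃ y, adj (n - 1) x y
  three : ∀ {v x v' x' w}, 4 ≤ n → adj (n - 2) v v' → adj n v x → adj (n - 2) x x' →
    (¬∃ y, adj (n - 1) v y) → adj (n - 1) v' w →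
    ((∃ y, adj (n - 1) x' y) ↔ ∃ y, adj n w y)

theorem dualEquiv_cons₃ {i : ℕ} {p q r : ℤ} {t l : List ℤ} (h : i < t.length) :
    DualEquiv i (r :: q :: p :: t) l ↔ ∃ m, l = r :: q :: p :: m ∧ DualEquiv i t m := by
  rw [dualEquiv_cons (by simp; omega)]
  constructor
  · rintro ⟨m, rfl, hm⟩
    obtain ⟨m, rfl, h₁⟩ := (dualEquiv_cons (l := p :: t) (by simp; omega)).1 hm
    obtain ⟨m, rfl, h₂⟩ := (dualEquiv_cons h.ne').1 h₁
    exact ⟨m, rfl, h₂⟩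
  · rintro ⟨m, rfl, hm⟩
    exact ⟨_, rfl, (hm.cons p).cons q⟩

/-! ### Edges of the largest color are dual equivalences -/

namespace IsLabelling

variable {V : Type*} {n : ℕ} {adj : ℕ → V → V → Prop} {Φ : V → List ℤ}

theorem lift (H : IsLabelling n adj Φ) {i : ℕ} {v : V} {l : List ℤ} (hi : i < n)
    (h : DualEquiv i (Φ v) l) : ∃ u, adj i v u ∧ Φ u = l := by
  obtain ⟨u, hu⟩ := (H.exists_iff v h.two_le_lt.1 hi.le).2 ⟨l, h⟩
  exact ⟨u, hu, (H.dual hi hu).unique h⟩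

theorem exists_top (H : IsLabelling n adj Φ) {v : V} {a b c : ℤ} {t : List ℤ}
    (hv : Φ v = c :: b :: a :: t) :
    (∃ x, adj n v x) ↔ (a < b ∧ c < b ∨ b < a ∧ b < c) := by
  have hl := H.length v
  have hs := H.std v
  rw [hv] at hl hs
  simp only [List.length_cons] at hl
  rw [H.exists_iff v (by omega) le_rfl, hv]
  exact exists_dualEquiv_top_iff (by omega) hs

theorem exists_below (H : IsLabelling n adj Φ) {v : V} {a b c d : ℤ} {t : List ℤ}
    (hv : Φ v = d :: c :: b :: a :: t) :
    (∃ x, adj (n - 1) v x) ↔ (a < b ∧ c < b ∨ b < a ∧ b < c) := by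
  have hl := H.length v
  have hs := H.std v
  rw [hv] at hl hs
  simp only [List.length_cons] at hl
  rw [H.exists_iff v (by omega) (by omega), hv, exists_dualEquiv_cons_iff (by simp; omega)]
  exact exists_dualEquiv_top_iff (by omega) hs.2

/-- A dual equivalence inside `t` has color below `t.length = n - 2`, hence at distance at least 3
from `n`, and axiom 5 completes the square. -/
theorem exists_pair_step (H : IsLabelling n adj Φ) {v x : V} {p q r p' q' r' : ℤ}
    {t t' m : List ℤ} {i : ℕ} (h : adj n v x) (hv : Φ v = r :: q :: p :: t)
    (hx : Φ x = r' :: q' :: p' :: t') (hm : DualEquiv i t m) :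
    ∃ v₂ x₂ m', adj n v₂ x₂ ∧ Φ v₂ = r :: q :: p :: m ∧ Φ x₂ = r' :: q' :: p' :: m' ∧
      DualEquiv i t' m' := by
  have hlv := H.length v
  have hlx := H.length x
  rw [hv] at hlv
  rw [hx] at hlx
  simp only [List.length_cons] at hlv hlx
  have hi := hm.two_le_lt.2
  obtain ⟨v₂, h₁, h₂⟩ := H.lift (i := i) (v := v) (l := r :: q :: p :: m) (by omega)
    (hv ▸ (dualEquiv_cons₃ hi).2 ⟨m, rfl, hm⟩)
  obtain ⟨y, h₃, h₄⟩ := H.comm (by omega) (H.symm h₁) h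
  have h₅ := H.dual (by omega) (H.symm h₄)
  rw [hx] at h₅
  obtain ⟨m', h₆, h₇⟩ := (dualEquiv_cons₃ (by omega)).1 h₅
  exact ⟨v₂, y, m', h₃, h₂, h₆, h₇⟩

theorem tail_eq (H : IsLabelling n adj Φ) {v x : V} {p q r p' q' r' : ℤ} {t t' : List ℤ}
    (h : adj n v x) (hv : Φ v = r :: q :: p :: t) (hx : Φ x = r' :: q' :: p' :: t') :
    t = t' := by
  -- The signs of the tails have indices `j < n - 2`, exactly those that axiom 2 preserves along an
  -- edge of color `n`.
  refine eq_of_bisimulation t.length (fun s s' => ∃ v x, adj n v x ∧ Φ v = r :: q :: p :: s ∧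
    Φ x = r' :: q' :: p' :: s') ?_ ?_ ⟨v, x, h, hv, hx⟩
  · rintro s s' ⟨v₂, x₂, h₂, hv₂, hx₂⟩
    have l₁ := H.length v
    have l₂ := H.length v₂
    have l₃ := H.length x₂
    rw [hv] at l₁
    rw [hv₂] at l₂
    rw [hx₂] at l₃
    simp only [List.length_cons] at l₁ l₂ l₃
    refine ⟨(hv₂ ▸ H.std v₂).2.2.2, (hx₂ ▸ H.std x₂).2.2.2, by omega, by omega, ?_⟩
    intro j hj hj'
    have := H.sgn_eq h₂ hj (by omega)
    rwa [hv₂, hx₂, sgn_cons (by simp; omega), sgn_cons (by simp; omega),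
      sgn_cons (by omega), sgn_cons (by simp; omega), sgn_cons (by simp; omega),
      sgn_cons (by omega)] at this
  · rintro i s s' m ⟨v₂, x₂, h₂, hv₂, hx₂⟩ hm
    obtain ⟨v₃, x₃, m', h₃, hv₃, hx₃, hm'⟩ := H.exists_pair_step h₂ hv₂ hx₂ hm
    exact ⟨m', hm', v₃, x₃, h₃, hv₃, hx₃⟩

/-- The edges of color `n` do not depend on the positions of the `n - 2` smallest entries. -/
theorem exists_pair (H : IsLabelling n adj Φ) {v x : V} {p q r p' q' r' : ℤ} {s t : List ℤ}
    (h : adj n v x) (hv : Φ v = r :: q :: p :: t) (hx : Φ x = r' :: q' :: p' :: t)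
    (hs : IsStd s) (hlen : s.length = t.length) (hsh : shape s = shape t) :
    ∃ v₂ x₂, adj n v₂ x₂ ∧ Φ v₂ = r :: q :: p :: s ∧ Φ x₂ = r' :: q' :: p' :: s := by
  have ht : IsStd t := (hv ▸ H.std v : IsStd (r :: q :: p :: t)).2.2.2
  have hts := reflTransGen_linked ht hs hlen.symm hsh.symm
  clear hs hlen hsh
  induction hts with
  | refl => exact ⟨v, x, h, hv, hx⟩
  | tail _ hm ih =>
    obtain ⟨i, hi⟩ := hm
    obtain ⟨v₂, x₂, h₂, hv₂, hx₂⟩ := ih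
    obtain ⟨v₃, x₃, m', h₃, hv₃, hx₃, hm'⟩ := H.exists_pair_step h₂ hv₂ hx₂ hi
    obtain rfl := hi.unique hm'
    exact ⟨v₃, x₃, h₃, hv₃, hx₃⟩

theorem lt_cases (H : IsLabelling n adj Φ) {v x : V} {p q r p' q' r' : ℤ} {t t' : List ℤ}
    (h : adj n v x) (hv : Φ v = r :: q :: p :: t) (hx : Φ x = r' :: q' :: p' :: t') :
    p < q ∧ r < q ∧ q' < p' ∧ q' < r' ∨ q < p ∧ q < r ∧ p' < q' ∧ r' < q' := by
  have l₁ := H.length v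
  have l₂ := H.length x
  have h₁ := H.sgn_neg h
  have h₃ := (H.exists_top hv).1 ⟨x, h⟩
  have h₄ := (H.exists_top hx).1 ⟨v, H.symm h⟩
  rw [hv] at l₁
  rw [hx] at l₂
  simp only [List.length_cons] at l₁ l₂
  rw [hv, hx, sgn_top (by simp; omega), sgn_top (by simp; omega)] at h₁
  have : q < r ↔ ¬ q' < r' := by
    split_ifs at h₁ with h₅ h₆ h₆
    · exact absurd h₁ (by decide)
    · exact iff_of_true h₅ h₆
    · exact iff_of_false h₅ (not_not.2 h₆)
    · exact absurd h₁ (by decide)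
  omega

/-- Put a corner `c` between `p` and `p'` on top of the common tail. As `q` and `q'` are extremal in
opposite directions, either both ends of the edge have an `(n - 1)`-edge or neither has. Axiom 4
excludes neither, and both forces a double edge. The pair is thus related by a dual equivalence of
color `n - 1`, which is already understood. -/
theorem swap_of_ne (H : IsLabelling n adj Φ) {v x : V} {p q r p' q' r' : ℤ} {t : List ℤ}
    (h : adj n v x) (hv : Φ v = r :: q :: p :: t) (hx : Φ x = r' :: q' :: p' :: t)
    (hne : p ≠ p') : p' = q ∧ q' = p ∧ r' = r := by
  have hsv : IsStd (r :: q :: p :: t) := hv ▸ H.std v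
  have hsx : IsStd (r' :: q' :: p' :: t) := hx ▸ H.std x
  obtain ⟨c, hc, hb⟩ := exists_removable_between hsv.2.2.1 hsx.2.2.1 hne
  obtain ⟨s, h₁, h₂, h₃⟩ := exists_isStd_cons hsv.2.2.2 hc
  obtain ⟨v₂, x₂, h₄, hv₂, hx₂⟩ := H.exists_pair h hv hx h₁ h₃ h₂
  have hlt := H.lt_cases h hv hx
  have hlen := H.length v₂
  rw [hv₂] at hlen
  simp only [List.length_cons] at hlen
  have e₁ := H.exists_below hv₂
  have e₂ := H.exists_below hx₂
  unfold Between at hb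
  obtain ⟨a, ha⟩ : ∃ a, adj (n - 1) v₂ a := by
    rcases H.two' (by omega) h₄ with h | h
    · exact h
    · rw [e₁]
      rw [e₂] at h
      omega
  have hx₃ : ∃ a, adj (n - 1) x₂ a := by
    rw [e₂]
    have := e₁.1 ⟨a, ha⟩
    omega
  rcases H.two (by omega) ha h₄ with rfl | ⟨-, h₅⟩
  · have := H.dual (by omega) ha
    rw [hv₂, hx₂, dualEquiv_cons (by simp; omega)] at this
    obtain ⟨m, hm, hd⟩ := this
    rw [dualEquiv_top (by omega)] at hd
    simp only [List.cons.injEq] at hm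
    obtain ⟨rfl, rfl⟩ := hm
    rcases hd with ⟨-, hd⟩ | ⟨-, hd⟩ <;> simp only [List.cons.injEq] at hd <;> omega
  · exact absurd hx₃ h₅

/-- If `r` were between `p` and `q`, a corner between `p` and `q` on top of the tail would give `v`
an `(n - 1)`-neighbor with `p` and `q` exchanged. That neighbor still has an `n`-edge, so axiom 4
makes it equal to `x`, whose third content would be `q` and not `p`. -/
theorem not_between (H : IsLabelling n adj Φ) {v x : V} {p q r q' r' : ℤ} {t : List ℤ}
    (h : adj n v x) (hv : Φ v = r :: q :: p :: t) (hx : Φ x = r' :: q' :: p :: t) :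
    ¬ Between p r q := by
  intro hr
  unfold Between at hr
  have hsv : IsStd (r :: q :: p :: t) := hv ▸ H.std v
  have hq : Addable (shape t) q :=
    (addable_moveBead_iff (k := p) (by omega)).1 hsv.2.1
  obtain ⟨c, hc, hb⟩ := exists_removable_between hsv.2.2.1 hq (by omega)
  obtain ⟨s, h₁, h₂, h₃⟩ := exists_isStd_cons hsv.2.2.2 hc
  obtain ⟨v₂, x₂, h₄, hv₂, hx₂⟩ := H.exists_pair h hv hx h₁ h₃ h₂
  have hlen := H.length v₂
  rw [hv₂] at hlen
  simp only [List.length_cons] at hlen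
  obtain ⟨a, ha, ha'⟩ := H.lift (i := n - 1) (v := v₂) (l := r :: p :: q :: c :: s) (by omega) (by
    rw [hv₂]
    exact DualEquiv.cons _ ((dualEquiv_top (by omega)).2 (.inr ⟨hb, rfl⟩)))
  have hay := (H.exists_top ha').2 (by omega)
  rcases H.two (by omega) ha h₄ with rfl | ⟨h₅, -⟩
  · rw [ha'] at hx₂
    simp only [List.cons.injEq] at hx₂
    omega
  · exact h₅ hay

/-- Otherwise a corner `c` lies between `q'` and `r`, on the side of `p` away from `q`. Exchanging
`p` and `c` at both ends by color `n - 2` turns the two conditions compared by `IsLabelling.three`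
into comparisons of `c` with `q'` and of `c` with `r`, and these disagree. -/
theorem middle_eq (H : IsLabelling n adj Φ) {v x : V} {p q r q' r' : ℤ} {t : List ℤ}
    (h : adj n v x) (hv : Φ v = r :: q :: p :: t) (hx : Φ x = r' :: q' :: p :: t)
    (hlt : r < p ∧ p < q ∧ q' < p ∧ p < r' ∨ q < p ∧ p < r ∧ p < q' ∧ r' < p) : q' = r := by
  by_contra hne
  have hsv : IsStd (r :: q :: p :: t) := hv ▸ H.std v
  have hsx : IsStd (r' :: q' :: p :: t) := hx ▸ H.std x
  have hr : Addable (shape (p :: t)) r :=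
    (addable_moveBead_iff (k := q) (by omega)).1 hsv.1
  obtain ⟨c, hc, hb⟩ := exists_removable_between hsx.2.1 hr hne
  unfold Between at hb
  -- The cell `m` between `p` and `c` is the witness that lets color `n - 2` exchange them.
  obtain ⟨m, s, hm, h₁, h₁', h₂, h₃, -⟩ := exists_isStd_cons_cons_cons hsv.2.2 hc (by omega)
  obtain ⟨v₂, x₂, h₄, hv₂, hx₂⟩ := H.exists_pair h hv hx h₁.2 h₃ h₂
  have hlen := H.length v₂
  rw [hv₂] at hlen
  simp only [List.length_cons] at hlen
  have low : ∀ a b : ℤ, DualEquiv (n - 2) (a :: b :: p :: c :: m :: s)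
      (a :: b :: c :: p :: m :: s) := fun a b =>
    DualEquiv.cons _ (DualEquiv.cons _ ((dualEquiv_top (by omega)).2
      (.inr ⟨by unfold Between at hm ⊢; omega, rfl⟩)))
  obtain ⟨v₃, hv₃, hv₃'⟩ := H.lift (i := n - 2) (v := v₂) (by omega) (hv₂ ▸ low r q)
  obtain ⟨x₃, hx₃, hx₃'⟩ := H.lift (i := n - 2) (v := x₂) (by omega) (hx₂ ▸ low r' q')
  obtain ⟨w, hw, hw'⟩ := H.lift (i := n - 1) (v := v₃) (l := r :: c :: q :: p :: m :: s)
    (by omega) (by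
      rw [hv₃']
      exact DualEquiv.cons _ ((dualEquiv_top (by simp; omega)).2
        (.inr ⟨by unfold Between; omega, rfl⟩)))
  have := H.three (by omega) hv₃ h₄ hx₃ (by rw [H.exists_below hv₂]; omega) hw
  rw [H.exists_below hx₃', H.exists_top hw'] at this
  omega

theorem dualEquiv_of_adj (H : IsLabelling n adj Φ) {v x : V} (hn : 2 ≤ n) (h : adj n v x) :
    DualEquiv n (Φ v) (Φ x) := by
  have key : ∀ u, ∃ r q p t, Φ u = r :: q :: p :: t ∧ t.length + 2 = n := by
    intro u
    have := H.length u
    match hu : Φ u, this with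
    | [], h => simp at h
    | [_], h => simp at h; omega
    | [_, _], h => simp at h; omega
    | r :: q :: p :: t, h => exact ⟨r, q, p, t, rfl, by simpa using h⟩
  obtain ⟨r, q, p, t, hv, hlen⟩ := key v
  obtain ⟨r', q', p', t', hx, -⟩ := key x
  obtain rfl := H.tail_eq h hv hx
  have hlt := H.lt_cases h hv hx
  have hs : IsStd (r :: q :: p :: t) := hv ▸ H.std v
  have hs' : IsStd (r' :: q' :: p' :: t) := hx ▸ H.std x
  rw [hv, hx, dualEquiv_top hlen]
  by_cases hp : p = p'
  · subst hp
    have h₁ := H.not_between h hv hx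
    have h₂ := H.not_between (H.symm h) hx hv
    have h₃ := hs.ne'
    have h₄ := hs'.ne'
    unfold Between at h₁ h₂ ⊢
    -- Since `q` is extremal and `r` is not between `p` and `q`, it is `p` that lies between. The
    -- same holds at the other end, and `middle_eq` in both directions gives `q' = r` and `r' = q`.
    obtain rfl := H.middle_eq h hv hx (by omega)
    obtain rfl := H.middle_eq (H.symm h) hx hv (by omega)
    exact .inr ⟨by omega, rfl⟩
  · obtain ⟨rfl, rfl, rfl⟩ := H.swap_of_ne h hv hx hp
    exact .inl ⟨by unfold Between; omega, rfl⟩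

end IsLabelling

end ContentVector

/-! ### Diagrams of partitions -/

theorem Nat.Partition.rowLens_diagram {n : ℕ} (p : n.Partition) :
    p.diagram.rowLens = p.parts.sort (· ≥ ·) :=
  YoungDiagram.rowLens_ofRowLens_eq_self fun _ h => p.parts_pos ((Multiset.mem_sort _).1 h)

theorem Nat.Partition.diagram_injective {n : ℕ} :
    Function.Injective (Nat.Partition.diagram (n := n)) := by
  intro p q h
  refine Nat.Partition.ext ?_
  rw [← Multiset.sort_eq p.parts (· ≥ ·), ← p.rowLens_diagram, h, q.rowLens_diagram,
    Multiset.sort_eq]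

theorem YoungDiagram.sum_rowLens (μ : YoungDiagram) : μ.rowLens.sum = μ.card := by
  have h : ∀ c ∈ μ.cells, c.1 ∈ Finset.range (μ.colLen 0) := by
    intro c hc
    rw [Finset.mem_range, ← YoungDiagram.mem_iff_lt_colLen]
    exact μ.up_left_mem le_rfl (Nat.zero_le _) hc
  have h₁ : μ.card = ∑ i ∈ Finset.range (μ.colLen 0), (μ.row i).card :=
    Finset.card_eq_sum_card_fiberwise h
  rw [h₁]
  simp only [← YoungDiagram.rowLen_eq_card, YoungDiagram.rowLens]
  rfl

theorem YoungDiagram.exists_partition {n : ℕ} (μ : YoungDiagram) (h : μ.card = n) :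
    ∃ p : n.Partition, p.diagram = μ := by
  let p : n.Partition := ⟨μ.rowLens, fun {i} hi => μ.pos_of_mem_rowLens i hi, by
    rw [Multiset.sum_coe, μ.sum_rowLens, h]⟩
  refine ⟨p, ?_⟩
  have hs : p.parts.sort (· ≥ ·) = μ.rowLens := by
    refine List.Perm.eq_of_pairwise' (r := (· ≥ ·)) (Multiset.pairwise_sort _ _)
      μ.rowLens_sorted.pairwise ?_
    exact Multiset.coe_eq_coe.1 (Multiset.sort_eq _ _)
  conv_rhs => rw [← YoungDiagram.ofRowLens_to_rowLens_eq_self (μ := μ)]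
  unfold Nat.Partition.diagram
  congr 1

namespace ContentVector

/-! ### Tableaux from content vectors -/

/-- The cell of content `k` added to a shape with `l.count k` cells of content `k`. -/
def newCell (k : ℤ) (l : List ℤ) : ℕ × ℕ :=
  (l.count k + (-k).toNat, l.count k + k.toNat)

/-- The entries of the tableau with a given content vector. -/
def entry : List ℤ → ℕ × ℕ → ℕ
  | [], _ => 0
  | k :: l, c => if c = newCell k l then l.length + 1 else entry l c

/-- The cells of the tableau with a given content vector. -/
def cells (l : List ℤ) : Set (ℕ × ℕ) := {c | min c.1 c.2 < l.count ((c.2 : ℤ) - c.1)}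

theorem mem_cells {l : List ℤ} {c : ℕ × ℕ} :
    c ∈ cells l ↔ min c.1 c.2 < l.count ((c.2 : ℤ) - c.1) := Iff.rfl

theorem newCell_eq_iff {k : ℤ} {l : List ℤ} {c : ℕ × ℕ} :
    c = newCell k l ↔ (c.2 : ℤ) - c.1 = k ∧ min c.1 c.2 = l.count k := by
  rw [newCell, Prod.ext_iff]
  simp only
  omega

theorem cells_cons {k : ℤ} {l : List ℤ} : cells (k :: l) = insert (newCell k l) (cells l) := by
  ext c
  rw [Set.mem_insert_iff, newCell_eq_iff, mem_cells, mem_cells, List.count_cons]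
  by_cases h : (c.2 : ℤ) - c.1 = k
  · subst h
    simp
    omega
  · rw [if_neg (by simpa using Ne.symm h)]
    simp [h]

theorem newCell_notMem {k : ℤ} {l : List ℤ} : newCell k l ∉ cells l := by
  have h := (newCell_eq_iff (k := k) (l := l)).1 rfl
  rw [mem_cells, h.1]
  omega

theorem entry_newCell {k : ℤ} {l : List ℤ} : entry (k :: l) (newCell k l) = l.length + 1 := by
  rw [entry, if_pos rfl]

theorem entry_le_length (l : List ℤ) (c : ℕ × ℕ) : entry l c ≤ l.length := by
  induction l with
  | nil => simp [entry]
  | cons k l ih =>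
    rw [entry, List.length_cons]
    split_ifs <;> omega

theorem entry_eq_zero {l : List ℤ} {c : ℕ × ℕ} (h : c ∉ cells l) : entry l c = 0 := by
  induction l with
  | nil => rfl
  | cons k l ih =>
    rw [cells_cons, Set.mem_insert_iff, not_or] at h
    rw [entry, if_neg h.1, ih h.2]

theorem bijOn_entry (l : List ℤ) : Set.BijOn (entry l) (cells l) (Set.Icc 1 l.length) := by
  induction l with
  | nil =>
    have : cells [] = ∅ := by ext c; simp [mem_cells]
    rw [this]
    simp
  | cons k l ih =>
    have h₁ : Set.BijOn (entry (k :: l)) (cells l) (Set.Icc 1 l.length) := by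
      refine ih.congr fun c hc => ?_
      rw [entry, if_neg]
      rintro rfl
      exact newCell_notMem hc
    have h₂ := h₁.insert (a := newCell k l) (by rw [entry_newCell]; simp)
    rw [entry_newCell] at h₂
    rw [cells_cons, List.length_cons]
    convert h₂ using 1
    ext x
    simp only [Set.mem_Icc, Set.mem_insert_iff]
    omega

/-- A content vector is determined by its tableau. -/
theorem eq_of_entry_eq {l l' : List ℤ} (hlen : l.length = l'.length)
    (h : ∀ c, entry l c = entry l' c) : l = l' := by
  induction l generalizing l' with
  | nil => rw [List.length_eq_zero_iff.1 hlen.symm]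
  | cons k l ih =>
    obtain ⟨k', l', rfl⟩ := List.exists_cons_of_length_eq_add_one hlen.symm
    simp only [List.length_cons, Nat.add_right_cancel_iff] at hlen
    have h₁ := h (newCell k l)
    rw [entry_newCell, entry] at h₁
    split_ifs at h₁ with h₂
    · obtain rfl : k = k' := by
        rw [← ((newCell_eq_iff (k := k) (l := l)).1 rfl).1, (newCell_eq_iff.1 h₂).1]
      rw [ih hlen]
      intro c
      have h₃ := h c
      rw [entry, entry, ← h₂] at h₃
      split_ifs at h₃ with h₄
      · rw [h₄, entry_eq_zero newCell_notMem, h₂, entry_eq_zero newCell_notMem]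
      · exact h₃
    · have := entry_le_length l' (newCell k l)
      omega

/-- The bead set records the differences of the lengths of neighboring diagonals. -/
theorem count_sub_one {l : List ℤ} (hl : IsStd l) (x : ℤ) :
    (x ∈ shape l → l.count (x - 1) + (if x ≤ 0 then 1 else 0) = l.count x + 1) ∧
    (x ∉ shape l → l.count (x - 1) + (if x ≤ 0 then 1 else 0) = l.count x) := by
  induction l with
  | nil =>
    simp only [shape, Set.mem_Iic, List.count_nil]
    constructor <;> intro h <;> simp [h]
  | cons k l ih =>
    obtain ⟨h₁, h₂⟩ := ih hl.2
    obtain ⟨h₃, h₄⟩ := hl.1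
    simp only [List.count_cons, shape, mem_moveBead, beq_iff_eq]
    by_cases hx : x = k
    · subst hx
      rw [if_neg (by omega), if_pos rfl]
      grind
    · rw [if_neg (c := k = x) (by omega)]
      by_cases hx' : x = k + 1
      · subst hx'
        rw [if_pos (by omega)]
        grind
      · rw [if_neg (c := k = x - 1) (by omega)]
        grind

theorem shape_eq_of_cells_eq {l l' : List ℤ} (hl : IsStd l) (hl' : IsStd l')
    (h : cells l = cells l') : shape l = shape l' := by
  have hc : ∀ k, l.count k = l'.count k := by
    intro k
    by_contra hne
    rcases lt_or_gt_of_ne hne with hlt | hlt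
    · have h₁ := (newCell_eq_iff (k := k) (l := l)).1 rfl
      refine newCell_notMem (k := k) (l := l) ?_
      rw [h, mem_cells, h₁.1, h₁.2]
      exact hlt
    · have h₁ := (newCell_eq_iff (k := k) (l := l')).1 rfl
      refine newCell_notMem (k := k) (l := l') ?_
      rw [← h, mem_cells, h₁.1, h₁.2]
      exact hlt
  ext x
  have h₁ := count_sub_one hl x
  have h₂ := count_sub_one hl' x
  rw [hc, hc] at h₁
  by_cases h₃ : x ∈ shape l <;> by_cases h₄ : x ∈ shape l' <;> simp only [h₃, h₄, true_implies,
    not_true, not_false_eq_true, false_implies, and_true, true_and] at h₁ h₂ ⊢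
  all_goals omega

theorem cells_eq_of_perm {l l' : List ℤ} (h : l.Perm l') : cells l = cells l' := by
  ext c
  rw [mem_cells, mem_cells, h.count_eq]

theorem cells_left {l : List ℤ} (hl : IsStd l) {r c : ℕ} (h : (r, c + 1) ∈ cells l) :
    (r, c) ∈ cells l := by
  have h₁ := count_sub_one hl ((c : ℤ) + 1 - r)
  rw [mem_cells] at h ⊢
  dsimp only at h ⊢
  push_cast at h
  have e : (c : ℤ) + 1 - r - 1 = c - r := by ring
  rw [e] at h₁
  by_cases h₂ : (c : ℤ) + 1 - r ∈ shape l <;> simp only [h₂, true_implies,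
    not_true, not_false_eq_true, false_implies, and_true, true_and] at h₁ <;>
    split_ifs at h₁ <;> omega

theorem cells_below {l : List ℤ} (hl : IsStd l) {r c : ℕ} (h : (r + 1, c) ∈ cells l) :
    (r, c) ∈ cells l := by
  have h₁ := count_sub_one hl ((c : ℤ) - r)
  rw [mem_cells] at h ⊢
  dsimp only at h ⊢
  push_cast at h
  have e : (c : ℤ) - (r + 1) = c - r - 1 := by ring
  rw [e] at h
  by_cases h₂ : (c : ℤ) - r ∈ shape l <;> simp only [h₂, true_implies,
    not_true, not_false_eq_true, false_implies, and_true, true_and] at h₁ <;>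
    split_ifs at h₁ <;> omega

theorem isLowerSet_cells {l : List ℤ} (hl : IsStd l) : IsLowerSet (cells l) := by
  have h₁ : ∀ r c j, (r, c + j) ∈ cells l → (r, c) ∈ cells l := by
    intro r c j
    induction j with
    | zero => exact id
    | succ j ih => exact fun h => ih (cells_left hl h)
  have h₂ : ∀ r c j, (r + j, c) ∈ cells l → (r, c) ∈ cells l := by
    intro r c j
    induction j with
    | zero => exact id
    | succ j ih => exact fun h => ih (cells_below hl h)
  rintro ⟨a, b⟩ ⟨r, c⟩ ⟨hr, hc⟩ h
  obtain ⟨i, rfl⟩ := Nat.exists_eq_add_of_le (show r ≤ a from hr)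
  obtain ⟨j, rfl⟩ := Nat.exists_eq_add_of_le (show c ≤ b from hc)
  exact h₁ r c j (h₂ r _ i h)

theorem entry_lt_entry {l : List ℤ} (hl : IsStd l) {c d : ℕ × ℕ} (hd : d ∈ cells l)
    (h : c < d) : entry l c < entry l d := by
  induction l with
  | nil => simp [mem_cells] at hd
  | cons k l ih =>
    rw [cells_cons] at hd
    rcases hd with rfl | hd
    · rw [entry_newCell, entry, if_neg h.ne]
      exact Nat.lt_succ_of_le (entry_le_length _ _)
    · have hc := isLowerSet_cells hl.2 h.le hd
      rw [entry, entry, if_neg, if_neg]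
      · exact ih hl.2 hd
      · rintro rfl
        exact newCell_notMem hd
      · rintro rfl
        exact newCell_notMem hc

theorem exists_diagram {n : ℕ} {l : List ℤ} (hl : IsStd l) (hlen : l.length = n) :
    ∃ p : n.Partition, ∀ c, c ∈ p.diagram ↔ c ∈ cells l := by
  have hfin : (cells l).Finite :=
    Set.Finite.of_finite_image ((Set.finite_Icc 1 l.length).subset
      (bijOn_entry l).mapsTo.image_subset) (bijOn_entry l).injOn
  let μ : YoungDiagram := ⟨hfin.toFinset, by simpa using isLowerSet_cells hl⟩
  have hcard : μ.card = l.length := by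
    have h : (hfin.toFinset : Set (ℕ × ℕ)) = cells l := hfin.coe_toFinset
    have h₁ := bijOn_entry l
    rw [← h, ← Finset.coe_Icc] at h₁
    have h₂ := Finset.card_nbij (entry l) h₁.mapsTo h₁.injOn h₁.surjOn
    simpa using h₂
  obtain ⟨p, hp⟩ := μ.exists_partition (hcard.trans hlen)
  refine ⟨p, fun c => ?_⟩
  rw [hp]
  exact hfin.mem_toFinset

/-- The list `[f N, …, f 1]`. -/
def upto (f : ℕ → ℤ) : ℕ → List ℤ
  | 0 => []
  | N + 1 => f (N + 1) :: upto f N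

@[simp] theorem length_upto (f : ℕ → ℤ) (N : ℕ) : (upto f N).length = N := by
  induction N with
  | zero => rfl
  | succ N ih => rw [upto, List.length_cons, ih]

theorem upto_congr {f g : ℕ → ℤ} {N : ℕ} (h : ∀ j, 1 ≤ j → j ≤ N → f j = g j) :
    upto f N = upto g N := by
  induction N with
  | zero => rfl
  | succ N ih =>
    rw [upto, upto, h (N + 1) (by omega) le_rfl, ih fun j h₁ h₂ => h j h₁ (by omega)]

theorem sgn_upto (f : ℕ → ℤ) {i N : ℕ} (hi : 1 ≤ i) (hN : i < N) :
    sgn i (upto f N) = if f i < f (i + 1) then 1 else -1 := by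
  induction N with
  | zero => omega
  | succ N ih =>
    rw [upto]
    rcases Nat.lt_or_ge i N with h | h
    · rw [sgn_cons (by simp; omega), ih h]
    · obtain rfl : i = N := by omega
      obtain ⟨i, rfl⟩ := Nat.exists_eq_add_of_le' hi
      rw [upto, sgn_top (by simp)]

theorem upto_swap_of_lt (f : ℕ → ℤ) {a N : ℕ} (h : N < a) :
    upto (f ∘ Equiv.swap a (a + 1)) N = upto f N := by
  refine upto_congr fun j h₁ h₂ => ?_
  rw [Function.comp_apply, Equiv.swap_apply_of_ne_of_ne (by omega) (by omega)]

theorem upto_swap (f : ℕ → ℤ) (a : ℕ) :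
    upto (f ∘ Equiv.swap (a + 1) (a + 2)) (a + 2) = f (a + 1) :: f (a + 2) :: upto f a := by
  rw [upto, upto, upto_swap_of_lt f (by omega)]
  simp

/-- Written as a transposition of entries, a dual equivalence can be compared with the action of
`d_i` on words. -/
theorem dualEquiv_upto_iff {f : ℕ → ℤ} {i N : ℕ} (hi : 2 ≤ i) (hN : i < N) {l : List ℤ} :
    DualEquiv i (upto f N) l ↔
      Between (f (i - 1)) (f (i + 1)) (f i) ∧ l = upto (f ∘ Equiv.swap (i - 1) (i - 1 + 1)) N ∨
      Between (f i) (f (i - 1)) (f (i + 1)) ∧ l = upto (f ∘ Equiv.swap i (i + 1)) N := by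
  obtain ⟨i, rfl⟩ := Nat.exists_eq_add_of_le' hi
  induction N generalizing l with
  | zero => omega
  | succ N ih =>
    rcases Nat.lt_or_ge (i + 2) N with h | h
    · rw [upto, dualEquiv_cons (by simp; omega)]
      simp only [ih h, upto, Function.comp_apply]
      rw [Equiv.swap_apply_of_ne_of_ne (by omega) (by omega),
        Equiv.swap_apply_of_ne_of_ne (by omega) (by omega)]
      aesop
    · obtain rfl : N = i + 2 := by omega
      rw [upto_swap, upto, upto, upto, dualEquiv_top (by simp), upto]
      rw [show i + 2 - 1 = i + 1 by omega, upto_swap]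
      simp [Equiv.swap_apply_of_ne_of_ne]

/-- Cells on different diagonals do not affect each other's position, and later cells depend only on
the multiset of earlier contents. -/
theorem entry_upto_swap {f : ℕ → ℤ} {a N : ℕ} (ha : 1 ≤ a) (hN : a < N) (hne : f a ≠ f (a + 1))
    (c : ℕ × ℕ) : entry (upto (f ∘ Equiv.swap a (a + 1)) N) c =
      Equiv.swap a (a + 1) (entry (upto f N) c) := by
  obtain ⟨a, rfl⟩ := Nat.exists_eq_add_of_le' ha
  induction N with
  | zero => omega
  | succ N ih =>
    have hperm : ∀ N, a + 2 ≤ N →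
        (upto (f ∘ Equiv.swap (a + 1) (a + 2)) N).Perm (upto f N) := by
      intro N hN
      induction N, hN using Nat.le_induction with
      | base => rw [upto_swap]; exact List.Perm.swap ..
      | succ N hN ih =>
        rw [upto, upto, Function.comp_apply,
          Equiv.swap_apply_of_ne_of_ne (by omega) (by omega)]
        exact ih.cons _
    rcases Nat.lt_or_ge (a + 1) N with h | h
    · rw [upto, upto, entry, entry, ih h, Function.comp_apply,
        Equiv.swap_apply_of_ne_of_ne (by omega) (by omega), newCell, newCell,
        (hperm N h).count_eq]
      simp only [length_upto]
      split_ifs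
      · rw [Equiv.swap_apply_of_ne_of_ne (by omega) (by omega)]
      · rfl
    · obtain rfl : N = a + 1 := by omega
      have e₁ : newCell (f (a + 1)) (f (a + 2) :: upto f a) = newCell (f (a + 1)) (upto f a) := by
        rw [newCell, newCell, List.count_cons_of_ne hne.symm]
      have e₂ : newCell (f (a + 2)) (f (a + 1) :: upto f a) = newCell (f (a + 2)) (upto f a) := by
        rw [newCell, newCell, List.count_cons_of_ne hne]
      have e₃ : newCell (f (a + 1)) (upto f a) ≠ newCell (f (a + 2)) (upto f a) := by
        intro h
        exact hne ((newCell_eq_iff.1 h).1.symm.trans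
          ((newCell_eq_iff (k := f (a + 1)) (l := upto f a)).1 rfl).1 |>.symm)
      rw [upto_swap, upto, upto, entry, entry, entry, entry, e₁, e₂]
      simp only [List.length_cons, length_upto]
      have h₅ := entry_le_length (upto f a) c
      rw [length_upto] at h₅
      split_ifs with h₁ h₂ h₂
      · exact absurd (h₁.symm.trans h₂) e₃
      · exact (Equiv.swap_apply_left _ _).symm
      · exact (Equiv.swap_apply_right _ _).symm
      · exact (Equiv.swap_apply_of_ne_of_ne (by omega) (by omega)).symm

end ContentVector

/-! ### Content vectors of standard tableaux -/

namespace StandardTableau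

open ContentVector

variable {n : ℕ} {p : n.Partition}

/-- The entry of a cell. -/
def val (T : StandardTableau p) (c : ℕ × ℕ) : ℕ := T.1 c.1 c.2

theorem ext_val {T U : StandardTableau p} (h : ∀ c, T.val c = U.val c) : T = U :=
  Subtype.ext (SemistandardYoungTableau.ext fun i j => h (i, j))

theorem bijOn_val (T : StandardTableau p) : Set.BijOn T.val p.diagram.cells (Set.Icc 1 n) := T.2

theorem val_eq_zero (T : StandardTableau p) {c : ℕ × ℕ} (h : c ∉ p.diagram) : T.val c = 0 :=
  T.1.zeros h

theorem exists_val_eq (T : StandardTableau p) {j : ℕ} (h₁ : 1 ≤ j) (h₂ : j ≤ n) :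
    ∃ c ∈ p.diagram.cells, T.val c = j := T.bijOn_val.surjOn ⟨h₁, h₂⟩

open Classical in
/-- The cell that contains `j`. -/
noncomputable def cellOf (T : StandardTableau p) (j : ℕ) : ℕ × ℕ :=
  if h : ∃ c ∈ p.diagram.cells, T.val c = j then h.choose else 0

theorem cellOf_mem (T : StandardTableau p) {j : ℕ} (h₁ : 1 ≤ j) (h₂ : j ≤ n) :
    T.cellOf j ∈ p.diagram.cells := by
  rw [cellOf, dif_pos (T.exists_val_eq h₁ h₂)]
  exact (T.exists_val_eq h₁ h₂).choose_spec.1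

theorem val_cellOf (T : StandardTableau p) {j : ℕ} (h₁ : 1 ≤ j) (h₂ : j ≤ n) :
    T.val (T.cellOf j) = j := by
  rw [cellOf, dif_pos (T.exists_val_eq h₁ h₂)]
  exact (T.exists_val_eq h₁ h₂).choose_spec.2

theorem val_injOn (T : StandardTableau p) {c d : ℕ × ℕ} (hc : c ∈ p.diagram)
    (hd : d ∈ p.diagram) (h : T.val c = T.val d) : c = d :=
  T.bijOn_val.injOn hc hd h

theorem val_lt_val (T : StandardTableau p) {c d : ℕ × ℕ} (hd : d ∈ p.diagram) (h : c < d) :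
    T.val c < T.val d := by
  have hc : c ∈ p.diagram := p.diagram.isLowerSet h.le hd
  refine lt_of_le_of_ne ?_ fun e => h.ne (T.val_injOn hc hd e)
  have h₁ : (c.1, d.2) ∈ p.diagram := p.diagram.isLowerSet (a := d) ⟨h.le.1, le_rfl⟩ hd
  exact (T.1.row_weak_of_le h.le.2 h₁).trans (T.1.col_weak h.le.1 hd)

/-- The content of the cell that contains `j`. -/
noncomputable def contentOf (T : StandardTableau p) (j : ℕ) : ℤ :=
  ((T.cellOf j).2 : ℤ) - (T.cellOf j).1

/-- The contents of the cells that contain `n, …, 1`. -/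
noncomputable def contents (T : StandardTableau p) : List ℤ := upto T.contentOf n

/-- All cells weakly southwest of the cell of `j + 1`, other than itself, hold smaller entries.
Hence that cell is the next one on its diagonal, and `count_sub_one` turns the presence of its left
and lower neighbors into addability. -/
theorem contents_aux (T : StandardTableau p) {j : ℕ} (hj : j ≤ n) :
    IsStd (upto T.contentOf j) ∧
    (∀ c, c ∈ cells (upto T.contentOf j) ↔ c ∈ p.diagram ∧ T.val c ≤ j) ∧
    ∀ c, c ∈ p.diagram → T.val c ≤ j → entry (upto T.contentOf j) c = T.val c := by
  induction j with
  | zero =>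
    have h₀ : ∀ c, c ∈ p.diagram → ¬ T.val c ≤ 0 := fun c hc h => by
      have := (T.bijOn_val.mapsTo hc).1
      omega
    refine ⟨trivial, fun c => ⟨fun h => by simp [mem_cells, upto] at h,
      fun h => absurd h.2 (h₀ c h.1)⟩, fun c hc h => absurd h (h₀ c hc)⟩
  | succ j ih =>
    obtain ⟨h₁, h₂, h₃⟩ := ih (by omega)
    have hm := T.cellOf_mem (j := j + 1) (by omega) hj
    have hv := T.val_cellOf (j := j + 1) (by omega) hj
    rw [YoungDiagram.mem_cells] at hm
    have hlow : ∀ c, c < T.cellOf (j + 1) → c ∈ cells (upto T.contentOf j) := by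
      intro c hc
      have := T.val_lt_val hm hc
      exact (h₂ c).2 ⟨p.diagram.isLowerSet hc.le hm, by omega⟩
    have hnot : T.cellOf (j + 1) ∉ cells (upto T.contentOf j) := by
      intro h
      have := ((h₂ _).1 h).2
      omega
    rcases hc : T.cellOf (j + 1) with ⟨r, c⟩
    rw [hc] at hm hv hlow hnot
    have hk : T.contentOf (j + 1) = (c : ℤ) - r := by rw [contentOf, hc]
    set l := upto T.contentOf j with hl
    have hcount : min r c = l.count ((c : ℤ) - r) := by
      refine le_antisymm ?_ (not_lt.1 hnot)
      rcases r with _ | r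
      · simp
      rcases c with _ | c
      · simp
      have := hlow (r, c) (Prod.mk_lt_mk_of_lt_of_le (by omega) (by omega))
      rw [mem_cells] at this
      push_cast
      rw [show (c : ℤ) + 1 - (r + 1) = c - r by ring]
      dsimp only at this
      omega
    have hnew : (r, c) = newCell ((c : ℤ) - r) l := newCell_eq_iff.2 ⟨rfl, hcount⟩
    have hadd : Addable (shape l) ((c : ℤ) - r) := by
      have hleft : 0 < c → min r (c - 1) < l.count ((c : ℤ) - r - 1) := by
        intro hpos
        obtain ⟨c, rfl⟩ := Nat.exists_eq_add_of_le' hpos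
        have := hlow (r, c) (Prod.mk_lt_mk_of_le_of_lt le_rfl (by omega))
        rw [mem_cells] at this
        push_cast
        rwa [show (c : ℤ) + 1 - r - 1 = c - r by ring]
      have hdown : 0 < r → min (r - 1) c < l.count ((c : ℤ) - r + 1) := by
        intro hpos
        obtain ⟨r, rfl⟩ := Nat.exists_eq_add_of_le' hpos
        have := hlow (r, c) (Prod.mk_lt_mk_of_lt_of_le (by omega) le_rfl)
        rw [mem_cells] at this
        push_cast
        rwa [show (c : ℤ) - (r + 1) + 1 = c - r by ring]
      constructor
      · by_contra hx
        have := (count_sub_one h₁ ((c : ℤ) - r)).2 hx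
        split_ifs at this <;> omega
      · intro hx
        have := (count_sub_one h₁ ((c : ℤ) - r + 1)).1 hx
        rw [add_sub_cancel_right] at this
        split_ifs at this <;> omega
    rw [upto, ← hl, hk]
    refine ⟨⟨hadd, h₁⟩, fun d => ?_, fun d hd hdj => ?_⟩
    · rw [cells_cons, Set.mem_insert_iff, ← hnew, h₂]
      constructor
      · rintro (rfl | ⟨h₄, h₅⟩)
        · exact ⟨hm, hv.le⟩
        · exact ⟨h₄, by omega⟩
      · rintro ⟨h₄, h₅⟩
        by_cases h₆ : T.val d = j + 1
        · exact .inl (T.val_injOn h₄ hm (h₆.trans hv.symm))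
        · exact .inr ⟨h₄, by omega⟩
    · rw [entry, ← hnew]
      split_ifs with h₄
      · rw [h₄, hv, hl, length_upto]
      · refine h₃ d hd ?_
        by_contra h₅
        exact h₄ (T.val_injOn hd hm (by omega))

theorem isStd_contents (T : StandardTableau p) : IsStd T.contents := (T.contents_aux le_rfl).1

@[simp] theorem length_contents (T : StandardTableau p) : T.contents.length = n := length_upto _ _

theorem mem_cells_contents (T : StandardTableau p) {c : ℕ × ℕ} :
    c ∈ cells T.contents ↔ c ∈ p.diagram := by
  rw [contents, (T.contents_aux le_rfl).2.1]
  exact and_iff_left_of_imp fun h => (T.bijOn_val.mapsTo h).2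

theorem entry_contents (T : StandardTableau p) (c : ℕ × ℕ) : entry T.contents c = T.val c := by
  by_cases h : c ∈ p.diagram
  · exact (T.contents_aux le_rfl).2.2 c h (T.bijOn_val.mapsTo h).2
  · rw [entry_eq_zero (mt T.mem_cells_contents.1 h), T.val_eq_zero h]

theorem contents_injective : Function.Injective (contents (p := p)) := fun T U h =>
  ext_val fun c => by rw [← T.entry_contents, h, U.entry_contents]

theorem exists_contents_eq {l : List ℤ} (hl : IsStd l) (hlen : l.length = n)
    (h : ∀ c, c ∈ cells l ↔ c ∈ p.diagram) : ∃ T : StandardTableau p, T.contents = l := by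
  have hset : cells l = p.diagram.cells := by
    ext c
    rw [h, Finset.mem_coe, YoungDiagram.mem_cells]
  let S : SemistandardYoungTableau p.diagram :=
    { entry := fun i j => entry l (i, j)
      row_weak' := fun {i j₁ j₂} h₁ h₂ => (entry_lt_entry hl ((h _).2 h₂)
        (Prod.mk_lt_mk_of_le_of_lt le_rfl h₁)).le
      col_strict' := fun {i j₁ j₂} h₁ h₂ => entry_lt_entry hl ((h _).2 h₂)
        (Prod.mk_lt_mk_of_lt_of_le h₁ le_rfl)
      zeros' := fun {i j} h₁ => entry_eq_zero (mt (h _).1 h₁) }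
  let T : StandardTableau p := ⟨S, by
    have := bijOn_entry l
    rw [hset, hlen] at this
    exact this⟩
  refine ⟨T, eq_of_entry_eq (by simp [hlen]) fun c => ?_⟩
  rw [entry_contents]
  rfl

/-! ### Words and content vectors -/

theorem word_eq_map_iff {T U : StandardTableau p} {g : ℕ → ℕ} :
    U.word = T.word.map g ↔ ∀ c ∈ p.diagram, U.val c = g (T.val c) := by
  rw [word, word, List.map_map, List.map_inj_left]
  simp only [Finset.mem_sort, YoungDiagram.mem_cells]
  rfl

theorem word_injective : Function.Injective (word (p := p)) := by
  intro T U h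
  rw [← List.map_id U.word] at h
  refine ext_val fun c => ?_
  by_cases hc : c ∈ p.diagram
  · exact word_eq_map_iff.1 h c hc
  · rw [T.val_eq_zero hc, U.val_eq_zero hc]

theorem word_eq_map_swap_iff {T U : StandardTableau p} {a : ℕ} (ha : 1 ≤ a) (han : a < n)
    (hne : T.contentOf a ≠ T.contentOf (a + 1)) :
    U.word = T.word.map (Equiv.swap a (a + 1)) ↔
      U.contents = upto (T.contentOf ∘ Equiv.swap a (a + 1)) n := by
  have e : ∀ c, entry (upto (T.contentOf ∘ Equiv.swap a (a + 1)) n) c =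
      Equiv.swap a (a + 1) (T.val c) := fun c => by
    rw [entry_upto_swap ha han hne, ← T.entry_contents, contents]
  rw [word_eq_map_iff]
  constructor
  · refine fun h => eq_of_entry_eq (by simp) fun c => ?_
    rw [e, U.entry_contents]
    by_cases hc : c ∈ p.diagram
    · exact h c hc
    · rw [T.val_eq_zero hc, U.val_eq_zero hc,
        Equiv.swap_apply_of_ne_of_ne (by omega) (by omega)]
  · intro h c _
    rw [← e, ← h, U.entry_contents]

theorem contentOf_le_of_idxOf_lt (T : StandardTableau p) {j k : ℕ} (hj : 1 ≤ j) (hjn : j ≤ n)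
    (hk : 1 ≤ k) (hkn : k ≤ n) (h : T.word.idxOf j < T.word.idxOf k) :
    T.contentOf j ≤ T.contentOf k := by
  have hlen : T.word.length = (p.diagram.cells.sort contentLE).length := List.length_map _
  have key : ∀ i, 1 ≤ i → i ≤ n → ∃ h : T.word.idxOf i < (p.diagram.cells.sort contentLE).length,
      (p.diagram.cells.sort contentLE)[T.word.idxOf i] = T.cellOf i := by
    intro i h₁ h₂
    have hmem : i ∈ T.word := List.mem_map.2
      ⟨T.cellOf i, (Finset.mem_sort _).2 (T.cellOf_mem h₁ h₂), T.val_cellOf h₁ h₂⟩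
    have hlt := List.idxOf_lt_length_of_mem hmem
    refine ⟨hlen ▸ hlt, T.val_injOn ?_ ?_ ?_⟩
    · exact (YoungDiagram.mem_cells _).1 ((Finset.mem_sort _).1 (List.getElem_mem (hlen ▸ hlt)))
    · exact (YoungDiagram.mem_cells _).1 (T.cellOf_mem h₁ h₂)
    · rw [T.val_cellOf h₁ h₂]
      have := List.getElem_idxOf hlt
      simp only [word, List.getElem_map] at this
      exact this
  obtain ⟨h₁, h₂⟩ := key j hj hjn
  obtain ⟨h₃, h₄⟩ := key k hk hkn
  have h₅ := List.pairwise_iff_getElem.1 (Finset.pairwise_sort p.diagram.cells contentLE)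
    _ _ h₁ h₃ h
  rw [h₂, h₄, contentLE, Prod.Lex.toLex_le_toLex] at h₅
  rw [contentOf, contentOf]
  rcases h₅ with h₅ | h₅
  · exact h₅.le
  · exact h₅.1.le

theorem idxOf_word_ne (T : StandardTableau p) {j k : ℕ} (hj : 1 ≤ j) (hjn : j ≤ n)
    (h : j ≠ k) : T.word.idxOf j ≠ T.word.idxOf k := by
  intro e
  have hmem : j ∈ T.word := List.mem_map.2
    ⟨T.cellOf j, (Finset.mem_sort _).2 (T.cellOf_mem hj hjn), T.val_cellOf hj hjn⟩
  exact h ((List.idxOf_inj hmem).1 e)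

/-- The order within a diagonal never matters for signs and `d_i`: entries that differ by 1 or 2 lie
on different diagonals. -/
theorem idxOf_word_lt_iff (T : StandardTableau p) {j k : ℕ} (hj : 1 ≤ j) (hjn : j ≤ n)
    (hk : 1 ≤ k) (hkn : k ≤ n) (h : T.contentOf j ≠ T.contentOf k) :
    T.word.idxOf j < T.word.idxOf k ↔ T.contentOf j < T.contentOf k := by
  have h₁ := T.contentOf_le_of_idxOf_lt hj hjn hk hkn
  have h₂ := T.contentOf_le_of_idxOf_lt hk hkn hj hjn
  have h₃ := T.idxOf_word_ne hj hjn (k := k) fun e => h (by rw [e])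
  omega

theorem contentOf_ne (T : StandardTableau p) {j : ℕ} (hj : 1 ≤ j) (hjn : j < n) :
    T.contentOf j ≠ T.contentOf (j + 1) := by
  have h := (T.contents_aux (j := j + 1) hjn).1
  obtain ⟨j, rfl⟩ := Nat.exists_eq_add_of_le' hj
  exact (IsStd.ne h).symm

theorem contentOf_ne' (T : StandardTableau p) {j : ℕ} (hj : 1 ≤ j) (hjn : j + 1 < n) :
    T.contentOf j ≠ T.contentOf (j + 2) := by
  have h := (T.contents_aux (j := j + 2) hjn).1
  obtain ⟨j, rfl⟩ := Nat.exists_eq_add_of_le' hj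
  exact (IsStd.ne' h).symm

theorem descentSignature_eq (T : StandardTableau p) (i : Set.Ico 1 n) :
    T.descentSignature i = sgn i T.contents := by
  obtain ⟨i, h₁, h₂⟩ := i
  rw [descentSignature, contents, sgn_upto _ h₁ h₂]
  simp only [T.idxOf_word_lt_iff h₁ h₂.le (by omega) h₂ (T.contentOf_ne h₁ h₂)]

theorem word_eq_elementaryDualEquivalence_iff {T U : StandardTableau p} {i : ℕ} (hi : 1 < i)
    (hin : i < n) : T ≠ U ∧ U.word = elementaryDualEquivalence i T.word ↔
      DualEquiv i T.contents U.contents := by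
  obtain ⟨i, rfl⟩ := Nat.exists_eq_add_of_le' (show 2 ≤ i from hi)
  have n₁ := T.contentOf_ne (j := i + 1) (by omega) (by omega)
  have n₂ := T.contentOf_ne (j := i + 2) (by omega) (by omega)
  have n₃ := T.contentOf_ne' (j := i + 1) (by omega) (by omega)
  have e₁ := T.idxOf_word_lt_iff (by omega) (by omega) (by omega) (by omega) n₁
  have e₂ := T.idxOf_word_lt_iff (by omega) (by omega) (by omega) (by omega) n₂
  have e₃ := T.idxOf_word_lt_iff (by omega) (by omega) (by omega) (by omega) n₃
  have m₁ := T.idxOf_word_ne (j := i + 1) (k := i + 2) (by omega) (by omega) (by omega)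
  have m₂ := T.idxOf_word_ne (j := i + 2) (k := i + 3) (by omega) (by omega) (by omega)
  have m₃ := T.idxOf_word_ne (j := i + 1) (k := i + 3) (by omega) (by omega) (by omega)
  have w₁ := word_eq_map_swap_iff (U := U) (by omega) (by omega) n₁
  have w₂ := word_eq_map_swap_iff (U := U) (by omega) (by omega) n₂
  rw [contents, dualEquiv_upto_iff hi hin,
    show i + 2 - 1 = i + 1 by omega]
  simp only [add_assoc, Nat.reduceAdd] at *
  rw [← w₁, ← w₂]
  have hd₁ := Nat.dist.eq_1 (T.word.idxOf (i + 2)) (T.word.idxOf (i + 1))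
  have hd₂ := Nat.dist.eq_1 (T.word.idxOf (i + 2)) (T.word.idxOf (i + 3))
  have hne : ∀ g : Equiv.Perm ℕ, ∀ j, 1 ≤ j → j ≤ n → g j ≠ j → U.word = T.word.map g →
      T ≠ U := by
    rintro g j h₁ h₂ hg h rfl
    have := word_eq_map_iff.1 h _ (T.cellOf_mem h₁ h₂)
    rw [T.val_cellOf h₁ h₂] at this
    exact hg this.symm
  have hne₁ := hne (Equiv.swap (i + 1) (i + 2)) (i + 1) (by omega) (by omega) (by simp)
  have hne₂ := hne (Equiv.swap (i + 2) (i + 3)) (i + 2) (by omega) (by omega) (by simp)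
  rw [elementaryDualEquivalence]
  simp only [show i + 2 - 1 = i + 1 by omega, add_assoc, Nat.reduceAdd]
  unfold Between
  -- When `i` is not in the middle, the neighbor further from `i` is the one that is not in the
  -- middle either. So comparing distances amounts to asking which of `i ± 1` lies between the other
  -- two entries.
  split_ifs with h₁ h₂
  · constructor
    · rintro ⟨h, h'⟩
      exact absurd (word_injective h').symm h
    · rintro (⟨h, -⟩ | ⟨h, -⟩) <;> omega
  · constructor
    · rintro ⟨-, h⟩
      exact .inr ⟨by omega, h⟩
    · rintro (⟨h, -⟩ | ⟨-, h⟩)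
      · omega
      · exact ⟨hne₂ h, h⟩
  · rw [Equiv.swap_comm]
    constructor
    · rintro ⟨-, h⟩
      exact .inl ⟨by omega, h⟩
    · rintro (⟨-, h⟩ | ⟨h, -⟩)
      · exact ⟨hne₁ h, h⟩
      · omega

end StandardTableau

theorem standardDualEquivalenceGraph_adj_iff {n : ℕ} {p : n.Partition} {i : Set.Ioo 1 n}
    {T U : StandardTableau p} : ((standardDualEquivalenceGraph p).E i).Adj T U ↔
      ContentVector.DualEquiv i T.contents U.contents := by
  have h₁ := StandardTableau.word_eq_elementaryDualEquivalence_iff (T := T) (U := U) i.2.1 i.2.2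
  have h₂ := StandardTableau.word_eq_elementaryDualEquivalence_iff (T := U) (U := T) i.2.1 i.2.2
  rw [standardDualEquivalenceGraph, SimpleGraph.fromRel_adj]
  constructor
  · rintro ⟨hne, h | h⟩
    · exact h₁.1 ⟨hne, h⟩
    · exact (h₂.1 ⟨hne.symm, h⟩).symm
  · intro h
    exact ⟨(h₁.2 h).1, .inl (h₁.2 h).2⟩

namespace SignedColoredGraph

open ContentVector

/-! ### Local consequences of axiom 4 -/

/-- Edges never leave a component, so the model graph describes all edges at its vertices.
Statements about neighbors thereby reduce to finite checks on the models. -/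
theorem ComponentsAppearIn.exists_local {V : Type*} {k : ℕ} {F : Fin k → SimpleGraph V}
    {L : List (Σ m : ℕ, Fin k → SimpleGraph (Fin m))} (h : ComponentsAppearIn F L) (v : V) :
    ∃ P ∈ L, ∃ g : Fin P.1 → V, Function.Injective g ∧ v ∈ Set.range g ∧
      ∀ j u w, (F j).Adj (g u) w ↔ ∃ u', g u' = w ∧ (P.2 j).Adj u u' := by
  obtain ⟨P, hP, e, he⟩ := h ((⨆ j, F j).connectedComponentMk v)
  refine ⟨P, hP, fun u => (e.symm u).1, fun a b hab => e.symm.injective (Subtype.ext hab),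
    ⟨e ⟨v, rfl⟩, by simp⟩, fun j u w => ⟨fun hw => ?_, ?_⟩⟩
  · have hw' : (⨆ j, F j).Adj (e.symm u).1 w := SimpleGraph.iSup_adj.2 ⟨j, hw⟩
    have hmem : w ∈ ((⨆ j, F j).connectedComponentMk v).supp :=
      (SimpleGraph.ConnectedComponent.sound hw'.symm.reachable).trans (e.symm u).2
    refine ⟨e ⟨w, hmem⟩, by simp, ?_⟩
    have := (he j (e.symm u) ⟨w, hmem⟩).1 hw
    rwa [Equiv.apply_symm_apply] at this
  · rintro ⟨u', rfl, hu⟩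
    rw [he]
    simpa using hu

theorem twoColorComponents_unique : ∀ P ∈ twoColorComponents, ∀ v a x : Fin P.1,
    (P.2 0).Adj v a → (P.2 1).Adj v x →
      a = x ∨ (¬∃ y, (P.2 1).Adj a y) ∧ ¬∃ y, (P.2 0).Adj x y := by
  intro P hP
  simp only [twoColorComponents, List.mem_cons, List.not_mem_nil, or_false] at hP
  rcases hP with rfl | rfl | rfl <;> dsimp <;>
    simp only [SimpleGraph.fromEdgeSet_adj, SimpleGraph.bot_adj, Set.mem_singleton_iff,
      Sym2.eq_iff] <;> decide

theorem twoColorComponents_exists : ∀ P ∈ twoColorComponents, ∀ v x : Fin P.1,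
    (P.2 1).Adj v x → (∃ y, (P.2 0).Adj v y) ∨ ∃ y, (P.2 0).Adj x y := by
  intro P hP
  simp only [twoColorComponents, List.mem_cons, List.not_mem_nil, or_false] at hP
  rcases hP with rfl | rfl | rfl <;> dsimp <;>
    simp only [SimpleGraph.fromEdgeSet_adj, SimpleGraph.bot_adj, Set.mem_singleton_iff,
      Sym2.eq_iff] <;> decide

-- The hypotheses can be met only in the last two models: with five vertices both edges in the
-- conclusion exist, with six vertices neither does.
set_option synthInstance.maxSize 2000 in
set_option synthInstance.maxHeartbeats 200000 in
theorem threeColorComponents_iff : ∀ P ∈ threeColorComponents, ∀ v v' : Fin P.1,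
    (P.2 0).Adj v v' → (¬∃ y, (P.2 1).Adj v y) → ∀ x, (P.2 2).Adj v x → ∀ x', (P.2 0).Adj x x' →
      ∀ w, (P.2 1).Adj v' w → ((∃ y, (P.2 1).Adj x' y) ↔ ∃ y, (P.2 2).Adj w y) := by
  intro P hP
  simp only [threeColorComponents, List.mem_cons, List.not_mem_nil, or_false] at hP
  rcases hP with rfl | rfl | rfl | rfl <;> dsimp <;>
    simp only [SimpleGraph.fromEdgeSet_adj, SimpleGraph.bot_adj, Set.mem_singleton_iff,
      Set.mem_insert_iff, Sym2.eq_iff] <;> decide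

theorem ComponentsAppearIn.unique_of_two {V : Type*} {E F : SimpleGraph V}
    (h : ComponentsAppearIn ![E, F] twoColorComponents) {v a x : V} (ha : E.Adj v a)
    (hx : F.Adj v x) : a = x ∨ (¬∃ y, F.Adj a y) ∧ ¬∃ y, E.Adj x y := by
  obtain ⟨P, hP, g, hg, ⟨v, rfl⟩, H⟩ := h.exists_local v
  obtain ⟨a, rfl, ha'⟩ := (H 0 _ _).1 ha
  obtain ⟨x, rfl, hx'⟩ := (H 1 _ _).1 hx
  rcases twoColorComponents_unique P hP v a x ha' hx' with rfl | ⟨h₁, h₂⟩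
  · exact .inl rfl
  · refine .inr ⟨?_, ?_⟩
    · rintro ⟨y, hy⟩
      obtain ⟨z, -, hz⟩ := (H 1 _ _).1 hy
      exact h₁ ⟨z, hz⟩
    · rintro ⟨y, hy⟩
      obtain ⟨z, -, hz⟩ := (H 0 _ _).1 hy
      exact h₂ ⟨z, hz⟩

theorem ComponentsAppearIn.exists_of_two {V : Type*} {E F : SimpleGraph V}
    (h : ComponentsAppearIn ![E, F] twoColorComponents) {v x : V} (hx : F.Adj v x) :
    (∃ y, E.Adj v y) ∨ ∃ y, E.Adj x y := by
  obtain ⟨P, hP, g, hg, ⟨v, rfl⟩, H⟩ := h.exists_local v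
  obtain ⟨x, rfl, hx'⟩ := (H 1 _ _).1 hx
  refine (twoColorComponents_exists P hP v x hx').imp ?_ ?_ <;> rintro ⟨y, hy⟩ <;>
    exact ⟨g y, (H 0 _ _).2 ⟨y, rfl, hy⟩⟩

theorem ComponentsAppearIn.iff_of_three {V : Type*} {D E F : SimpleGraph V}
    (h : ComponentsAppearIn ![D, E, F] threeColorComponents) {v v' x x' w : V} (hv : D.Adj v v')
    (hx : F.Adj v x) (hx' : D.Adj x x') (hn : ¬∃ y, E.Adj v y) (hw : E.Adj v' w) :
    (∃ y, E.Adj x' y) ↔ ∃ y, F.Adj w y := by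
  obtain ⟨P, hP, g, hg, ⟨v, rfl⟩, H⟩ := h.exists_local v
  have H' : ∀ j u, (∃ y, ((![D, E, F] : Fin 3 → SimpleGraph V) j).Adj (g u) y) ↔
      ∃ y, (P.2 j).Adj u y := by
    intro j u
    constructor
    · rintro ⟨y, hy⟩
      obtain ⟨z, -, hz⟩ := (H j _ _).1 hy
      exact ⟨z, hz⟩
    · rintro ⟨y, hy⟩
      exact ⟨g y, (H j _ _).2 ⟨y, rfl, hy⟩⟩
  obtain ⟨v', rfl, a₁⟩ := (H 0 _ _).1 hv
  obtain ⟨x, rfl, a₂⟩ := (H 2 _ _).1 hx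
  obtain ⟨x', rfl, a₃⟩ := (H 0 _ _).1 hx'
  obtain ⟨w, rfl, a₄⟩ := (H 1 _ _).1 hw
  exact (H' 1 x').trans ((threeColorComponents_iff P hP v v' a₁ (mt (H' 1 v).2 hn) x a₂ x' a₃
    w a₄).trans (H' 2 w).symm)

/-! ### Labelling the vertices by content vectors -/

/-- Adjacency by an edge of color `i`, for an arbitrary natural number `i`. -/
def AdjColor {n N : ℕ} {V : Type*} [Finite V] (G : SignedColoredGraph n N V) (i : ℕ) (v x : V) :
    Prop := ∃ h : i ∈ Set.Ioo 1 n, (G.E ⟨i, h⟩).Adj v x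

variable {V : Type*} [Finite V] {n : ℕ} {G : SignedColoredGraph (n + 1) (n + 1) V}

/-- A labelling by content vectors of length `n` of the components of the restriction of a graph
of type `(n + 1, n + 1)`. -/
structure IsComponentLabelling {ι : Type*} (G : SignedColoredGraph (n + 1) (n + 1) V)
    (comp : V → ι) (tl : V → List ℤ) : Prop where
  comp_eq : ∀ {i v x}, i < n → G.AdjColor i v x → comp v = comp x
  std : ∀ v, IsStd (tl v)
  length : ∀ v, (tl v).length = n
  sign_eq : ∀ v (j : Set.Ico 1 (n + 1)), (j : ℕ) < n → G.sign v j = sgn j (tl v)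
  dual : ∀ {i v x}, i < n → G.AdjColor i v x → DualEquiv i (tl v) (tl x)
  inj : ∀ {v x}, comp v = comp x → tl v = tl x → v = x
  shape_eq : ∀ {v x}, comp v = comp x → shape (tl v) = shape (tl x)

theorem exists_componentLabelling
    (hstd : ∀ C : (G.restrict n.le_succ n.le_succ).underlying.ConnectedComponent,
      ∃ μ : n.Partition,
        ((G.restrict n.le_succ n.le_succ).induce C.supp).IsIsomorphic
          (standardDualEquivalenceGraph μ)) :
    ∃ tl : V → List ℤ, G.IsComponentLabelling
      (G.restrict n.le_succ n.le_succ).underlying.connectedComponentMk tl := by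
  choose μ φ hφ hbij using hstd
  -- The target of `φ C` depends on `C`. Passing to content vectors allows labels to be compared
  -- across equal components without casts.
  have key : ∀ C v (h : v ∈ C.supp), (φ C ⟨v, h⟩).contents =
      (φ ((G.restrict n.le_succ n.le_succ).underlying.connectedComponentMk v) ⟨v, rfl⟩).contents := by
    rintro C v rfl
    rfl
  have hcomp : ∀ {i v x}, i < n → G.AdjColor i v x →
      (G.restrict n.le_succ n.le_succ).underlying.connectedComponentMk v =
      (G.restrict n.le_succ n.le_succ).underlying.connectedComponentMk x := by
    rintro i v x hi ⟨h, hvx⟩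
    refine SimpleGraph.ConnectedComponent.sound (SimpleGraph.Adj.reachable ?_)
    exact SimpleGraph.iSup_adj.2 ⟨⟨i, h.1, hi⟩, hvx⟩
  refine ⟨fun v => (φ ((G.restrict n.le_succ n.le_succ).underlying.connectedComponentMk v)
    ⟨v, rfl⟩).contents, hcomp, fun v => StandardTableau.isStd_contents _,
    fun v => StandardTableau.length_contents _, ?_, ?_, ?_, ?_⟩
  · intro v j hj
    have := (hφ _).1 ⟨v, rfl⟩ ⟨j, j.2.1, hj⟩
    exact this.trans (StandardTableau.descentSignature_eq _ _)
  · intro i v x hi hvx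
    rw [← key _ x (hcomp hi hvx).symm]
    obtain ⟨h, hvx⟩ := hvx
    exact standardDualEquivalenceGraph_adj_iff.1 ((hφ _).2 ⟨i, h.1, hi⟩ ⟨v, rfl⟩ ⟨x, _⟩ hvx)
  · intro v x h e
    rw [← key _ x h.symm] at e
    have := (hbij _).1 (StandardTableau.contents_injective e)
    exact congrArg Subtype.val this
  · intro v x h
    rw [← key _ x h.symm]
    refine shape_eq_of_cells_eq (StandardTableau.isStd_contents _)
      (StandardTableau.isStd_contents _) ?_
    ext c
    rw [StandardTableau.mem_cells_contents, StandardTableau.mem_cells_contents]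

theorem exists_adjColor_iff {l : List ℤ} {v : V} (h1 : G.Axiom1) (hl : IsStd l)
    (hsign : ∀ j : Set.Ico 1 (n + 1), (j : ℕ) < l.length → G.sign v j = sgn j l)
    {i : ℕ} (hi : 1 < i) (hil : i < l.length) (hin : i ≤ n) :
    (∃ x, G.AdjColor i v x) ↔ ∃ l', DualEquiv i l l' := by
  have h := (h1 ⟨i, hi, by omega⟩ v).1 ⟨i - 1, by omega, by omega⟩ ⟨i, by omega, by omega⟩
    (by simp; omega) rfl
  rw [hsign _ (by simp; omega), hsign _ hil] at h
  rw [← sgn_eq_neg_iff hl hi hil]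
  refine Iff.trans ?_ h.symm
  exact ⟨fun ⟨x, _, hx⟩ => ⟨x, hx⟩, fun ⟨x, hx⟩ => ⟨x, ⟨hi, by omega⟩, hx⟩⟩

/-! ### The cell containing the new largest entry -/

namespace IsComponentLabelling

variable {ι : Type*} {comp : V → ι} {tl : V → List ℤ}

theorem lift (H : G.IsComponentLabelling comp tl) (h1 : G.Axiom1) {v : V} {i : ℕ} {l : List ℤ}
    (h : DualEquiv i (tl v) l) : ∃ u, G.AdjColor i v u ∧ comp v = comp u ∧ tl u = l := by
  have hi := h.two_le_lt
  have hlen := H.length v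
  obtain ⟨u, hu⟩ := (exists_adjColor_iff h1 (H.std v)
    (fun j hj => H.sign_eq v j (by omega)) hi.1 hi.2 (by omega)).2 ⟨l, h⟩
  exact ⟨u, hu, H.comp_eq (by omega) hu, (H.dual (by omega) hu).unique h⟩

theorem exists_eq (H : G.IsComponentLabelling comp tl) (h1 : G.Axiom1) {v : V} {l : List ℤ}
    (hl : IsStd l) (hlen : l.length = n) (hs : shape l = shape (tl v)) :
    ∃ u, comp v = comp u ∧ tl u = l := by
  have h := reflTransGen_linked (H.std v) hl ((H.length v).trans hlen.symm) hs.symm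
  clear hl hlen hs
  induction h with
  | refl => exact ⟨v, rfl, rfl⟩
  | tail _ h ih =>
    obtain ⟨u, hu, rfl⟩ := ih
    obtain ⟨i, hi⟩ := h
    obtain ⟨w, -, hw, rfl⟩ := H.lift h1 hi
    exact ⟨w, hu.trans hw, rfl⟩

/-- The last entry of the signature depends only on the content of the cell that contains `n`. -/
theorem sign_eq_of_head_eq (H : G.IsComponentLabelling comp tl) (h1 : G.Axiom1) (h2 : G.Axiom2)
    (hn : n ∈ Set.Ico 1 (n + 1)) {u v : V} {c : ℤ} {s t : List ℤ} (huv : comp u = comp v)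
    (hu : tl u = c :: s) (hv : tl v = c :: t) : G.sign u ⟨n, hn⟩ = G.sign v ⟨n, hn⟩ := by
  have hsu := H.std u
  have hsv := H.std v
  have hlu := H.length u
  have hlv := H.length v
  have hsh := H.shape_eq huv
  rw [hu, hv] at hsh
  rw [hu] at hsu hlu
  rw [hv] at hsv hlv
  simp only [List.length_cons] at hlu hlv
  -- With `n` fixed in its cell, the rest is connected by colors at most `n - 2`, and axiom 2 keeps
  -- the sign at `n` along such edges.
  have h := reflTransGen_linked hsu.2 hsv.2 (by omega) (shape_cons_injective hsh)
  have key : ∀ r, Relation.ReflTransGen Linked s r →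
      ∃ w, comp u = comp w ∧ tl w = c :: r ∧ G.sign u ⟨n, hn⟩ = G.sign w ⟨n, hn⟩ := by
    intro r hr
    induction hr with
    | refl => exact ⟨u, rfl, hu, rfl⟩
    | tail _ hm ih =>
      obtain ⟨w, h₁, h₂, h₃⟩ := ih
      obtain ⟨i, hi⟩ := hm
      have hlen := H.length w
      rw [h₂, List.length_cons] at hlen
      obtain ⟨x, ⟨h₄, h₅⟩, h₆, h₇⟩ := H.lift h1 (v := w) (h₂ ▸ hi.cons c)
      refine ⟨x, h₁.trans h₆, h₇, h₃.trans ?_⟩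
      have := hi.two_le_lt.2
      exact (h2 _ _ _ h₅ ⟨n, hn⟩).2 (.inr (by simp; omega))
  obtain ⟨w, h₁, h₂, h₃⟩ := key t h
  rw [h₃, H.inj (h₁.symm.trans huv) (h₂.trans hv.symm)]

/-- Along the removable cells of a shape, the last entry of the signature changes at most once. -/
theorem lt_of_sign (H : G.IsComponentLabelling comp tl) (h1 : G.Axiom1) (h2 : G.Axiom2)
    (h3 : G.Axiom3) (hn : n ∈ Set.Ico 1 (n + 1)) {u v : V} {k l : ℤ} {s t : List ℤ}
    (huv : comp u = comp v) (hu : tl u = k :: s) (hv : tl v = l :: t)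
    (hpos : G.sign u ⟨n, hn⟩ = 1) (hneg : G.sign v ⟨n, hn⟩ ≠ 1) : k < l := by
  have hne : l ≠ k := by
    rintro rfl
    exact hneg ((H.sign_eq_of_head_eq h1 h2 hn huv hu hv).symm.trans hpos)
  have hsu := H.std u
  have hlu := H.length u
  have hsh := H.shape_eq huv
  rw [hu, hv] at hsh
  rw [hu] at hsu hlu
  have hsv := H.std v
  rw [hv] at hsv
  -- An edge of color `n - 1` moves `n` from the corner `k` to the corner `l` and flips the sign at
  -- `n`. Axiom 3 then determines the sign at `n - 1`, which compares `k` with `l`.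
  obtain ⟨c, r, hb, h₁, h₂, h₃, h₄, h₅⟩ :=
    exists_isStd_cons_cons_cons hsu (hsh ▸ hsv.removable) hne
  simp only [List.length_cons] at hlu h₄
  obtain ⟨w, hw, hw'⟩ := H.exists_eq h1 (v := u) h₁ (by simp; omega)
    (by rw [hu, shape, h₃, shape])
  obtain ⟨x, ⟨hi, hx⟩, hx', hx''⟩ := H.lift h1 (v := w) (i := r.length + 2)
    (hw' ▸ (dualEquiv_top rfl).2 (.inr ⟨hb.symm, rfl⟩))
  have e₁ := H.sign_eq_of_head_eq h1 h2 hn hw hu hw'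
  have e₂ := H.sign_eq_of_head_eq h1 h2 hn (huv.symm.trans (hw.trans hx')) hv hx''
  have e₃ := (h3 _ _ _ hx).2 ⟨r.length + 2, by omega, by omega⟩ ⟨n, hn⟩ rfl (by simp; omega)
  rw [← e₁, ← e₂, hpos, (Int.units_eq_one_or _).resolve_left hneg, H.sign_eq _ _ (by simp; omega),
    hw', sgn_top (by simp)] at e₃
  have := e₃ (by simp)
  by_contra hlt
  rw [if_pos (by omega)] at this
  exact absurd this (by decide)

theorem _root_.ContentVector.exists_bound (l : List ℤ) :
    ∃ B : ℤ, (∀ x, x ≤ -B → x ∈ shape l) ∧ ∀ x, x ∈ shape l → x ≤ B := by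
  induction l with
  | nil => exact ⟨0, fun x hx => by simpa [shape] using hx, fun x hx => by simpa [shape] using hx⟩
  | cons k l ih =>
    obtain ⟨B, h₁, h₂⟩ := ih
    refine ⟨|B| + |k| + 2, fun x hx => ?_, fun x hx => ?_⟩
    · have := neg_abs_le k
      have := le_abs_self B
      have := abs_nonneg B
      have := abs_nonneg k
      exact .inr (.inr ⟨by omega, by omega, h₁ x (by omega)⟩)
    · have := le_abs_self k
      have := le_abs_self B
      have := abs_nonneg B
      rcases hx with ⟨h, -⟩ | ⟨h, -⟩ | ⟨-, -, h⟩
      · omega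
      · omega
      · have := h₂ x h
        have := abs_nonneg k
        omega

/-- A monotone distribution of signs to the removable cells is induced by an addable cell. -/
theorem _root_.ContentVector.exists_addable (l : List ℤ) (P : ℤ → Prop)
    (hP : ∀ c d, Removable (shape l) c → Removable (shape l) d → P c → ¬P d → c < d) :
    ∃ a, Addable (shape l) a ∧ ∀ c, Removable (shape l) c → (P c ↔ c < a) := by
  obtain ⟨B, hB₁, hB₂⟩ := ContentVector.exists_bound l
  -- The cell sought is the rightmost bead that is not to the right of any corner violating `P`.
  obtain ⟨a, ⟨ha, ha'⟩, hmax⟩ := Int.exists_greatest_of_bdd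
    (P := fun x => x ∈ shape l ∧ ∀ c, Removable (shape l) c → ¬P c → x ≤ c)
    ⟨B, fun x hx => hB₂ x hx.1⟩ ⟨-B, hB₁ _ le_rfl, fun c hc _ => by
      by_contra h
      exact hc.1 (hB₁ c (by omega))⟩
  have hadd : Addable (shape l) a := by
    refine ⟨ha, fun h => ?_⟩
    have : a + 1 ≤ a := hmax _ ⟨h, fun c hc hPc => by
      have h₁ := ha' c hc hPc
      have h₂ : a ≠ c := by
        rintro rfl
        exact hc.1 ha
      omega⟩
    omega
  refine ⟨a, hadd, fun c hc => ⟨fun hPc => ?_, fun hlt => ?_⟩⟩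
  · have : c + 1 ≤ a := hmax _ ⟨hc.2, fun d hd hPd => hP c d hc hd hPc hPd⟩
    omega
  · by_contra hPc
    have := ha' c hc hPc
    omega

/-- The labelling can be extended by a cell that contains `n + 1`. -/
theorem exists_extension (H : G.IsComponentLabelling comp tl) (h1 : G.Axiom1) (h2 : G.Axiom2)
    (h3 : G.Axiom3) : ∃ a : ι → ℤ, ∀ v, IsStd (a (comp v) :: tl v) ∧
      ∀ j : Set.Ico 1 (n + 1), G.sign v j = sgn j (a (comp v) :: tl v) := by
  have key : ∀ C : ι, ∃ a, ∀ v, comp v = C → Addable (shape (tl v)) a ∧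
      ∀ (hn : n ∈ Set.Ico 1 (n + 1)) c t, tl v = c :: t → (G.sign v ⟨n, hn⟩ = 1 ↔ c < a) := by
    intro C
    by_cases hC : ∃ v, comp v = C
    swap
    · exact ⟨0, fun v hv => absurd ⟨v, hv⟩ hC⟩
    obtain ⟨v, rfl⟩ := hC
    have hex : ∀ c, Removable (shape (tl v)) c → ∃ u t, comp v = comp u ∧ tl u = c :: t ∧
        n ∈ Set.Ico 1 (n + 1) := by
      intro c hc
      obtain ⟨t, h₁, h₂, h₃⟩ := exists_isStd_cons (H.std v) hc
      rw [H.length] at h₃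
      obtain ⟨u, hu, hu'⟩ := H.exists_eq h1 h₁ h₃ h₂
      rw [List.length_cons] at h₃
      exact ⟨u, t, hu, hu', by omega, by omega⟩
    obtain ⟨a, ha, ha'⟩ := exists_addable (tl v) (fun c => ∃ u t, comp v = comp u ∧
      tl u = c :: t ∧ ∃ hn : n ∈ Set.Ico 1 (n + 1), G.sign u ⟨n, hn⟩ = 1) (by
        rintro c d hc hd ⟨u, t, hu, hu', hn, hpos⟩ hneg
        obtain ⟨w, s, hw, hw', -⟩ := hex d hd
        exact H.lt_of_sign h1 h2 h3 hn (hu.symm.trans hw) hu' hw' hpos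
          fun h => hneg ⟨w, s, hw, hw', hn, h⟩)
    refine ⟨a, fun u hu => ⟨H.shape_eq hu ▸ ha, fun hn c t hc => ?_⟩⟩
    have hrem : Removable (shape (tl v)) c := by
      have hs := H.std u
      rw [hc] at hs
      rw [← H.shape_eq hu, hc]
      exact hs.removable
    rw [← ha' c hrem]
    constructor
    · exact fun h => ⟨u, t, hu.symm, hc, hn, h⟩
    · rintro ⟨w, s, hw, hw', hn', h⟩
      rwa [H.sign_eq_of_head_eq h1 h2 hn (hu.trans hw) hc hw']
  choose a ha using key
  refine ⟨a, fun v => ⟨⟨(ha _ v rfl).1, H.std v⟩, fun ⟨j, hj⟩ => ?_⟩⟩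
  have hlen := H.length v
  change G.sign v ⟨j, hj⟩ = sgn j _
  rcases Nat.lt_or_ge j n with h | h
  · rw [sgn_cons (by omega)]
    exact H.sign_eq v _ h
  · obtain rfl : j = n := by have := hj.2; omega
    obtain ⟨c, t, hc⟩ : ∃ c t, tl v = c :: t :=
      List.exists_cons_of_length_pos (by have := hj.1; omega)
    have h₁ := (ha _ v rfl).2 hj c t hc
    rw [hc, List.length_cons] at hlen
    rw [hc, sgn_top (by omega)]
    split_ifs with h₂
    · exact h₁.2 h₂
    · exact (Int.units_eq_one_or _).resolve_left fun h => h₂ (h₁.1 h)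

theorem isLabelling (H : G.IsComponentLabelling comp tl) (h1 : G.Axiom1) (h2 : G.Axiom2)
    (h4 : G.Axiom4) (h5 : G.Axiom5) {a : ι → ℤ} (ha : ∀ v, IsStd (a (comp v) :: tl v) ∧
      ∀ j : Set.Ico 1 (n + 1), G.sign v j = sgn j (a (comp v) :: tl v)) :
    IsLabelling n G.AdjColor fun v => a (comp v) :: tl v where
  symm := fun ⟨h, hv⟩ => ⟨h, hv.symm⟩
  std v := (ha v).1
  length v := by rw [List.length_cons, H.length]
  exists_iff v hi hin := exists_adjColor_iff h1 (ha v).1 (fun j _ => (ha v).2 j) hi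
    (by rw [List.length_cons, H.length]; omega) hin
  dual hi hv := by
    rw [H.comp_eq hi hv]
    exact (H.dual hi hv).cons _
  sgn_neg := fun {v x} ⟨h, hv⟩ => by
    have := (h2 _ _ _ hv ⟨n, by have := h.1; omega, by omega⟩).1 (.inr rfl)
    rwa [(ha v).2, (ha x).2] at this
  sgn_eq := fun {v x j} ⟨h, hv⟩ hj hjn => by
    have := (h2 _ _ _ hv ⟨j, hj, by omega⟩).2 (.inl hjn)
    rwa [(ha v).2, (ha x).2] at this
  comm := fun hi ⟨h, hv⟩ ⟨h', hw⟩ => by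
    obtain ⟨y, hy, hy'⟩ := h5 _ _ (.inl hi) _ _ _ hv hw
    exact ⟨y, ⟨h', hy⟩, ⟨h, hy'⟩⟩
  two := fun hn ⟨h, hv⟩ ⟨h', hw⟩ => by
    have := (h4.1 ⟨n - 1, h⟩ ⟨n, h'⟩ (by simp; omega)).unique_of_two hv hw
    exact this.imp_right fun ⟨h₁, h₂⟩ =>
      ⟨fun ⟨y, _, hy⟩ => h₁ ⟨y, hy⟩, fun ⟨y, _, hy⟩ => h₂ ⟨y, hy⟩⟩
  two' := fun hn ⟨h', hw⟩ => by
    have h : n - 1 ∈ Set.Ioo 1 (n + 1) := ⟨by omega, by omega⟩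
    have := (h4.1 ⟨n - 1, h⟩ ⟨n, h'⟩ (by simp; omega)).exists_of_two hw
    exact this.imp (fun ⟨y, hy⟩ => ⟨y, h, hy⟩) fun ⟨y, hy⟩ => ⟨y, h, hy⟩
  three := fun hn ⟨h, hv⟩ ⟨h', hx⟩ ⟨_, hx'⟩ hno ⟨h'', hw⟩ => by
    have := (h4.2 ⟨n - 2, h⟩ ⟨n - 1, h''⟩ ⟨n, h'⟩ (by simp; omega) (by simp; omega)).iff_of_three
      hv hx hx' (fun ⟨y, hy⟩ => hno ⟨y, h'', hy⟩) hw
    exact ⟨fun ⟨y, _, hy⟩ => (this.1 ⟨y, hy⟩).imp fun _ hz => ⟨h', hz⟩,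
      fun ⟨y, _, hy⟩ => (this.2 ⟨y, hy⟩).imp fun _ hz => ⟨h'', hz⟩⟩

end IsComponentLabelling

/-- A graph of type `(n + 1, n + 1)` satisfying the axioms, the components of whose restriction
are standard, can be labelled by content vectors compatibly with all edges. -/
theorem exists_labelling (h1 : G.Axiom1) (h2 : G.Axiom2) (h3 : G.Axiom3) (h4 : G.Axiom4)
    (h5 : G.Axiom5)
    (hstd : ∀ C : (G.restrict n.le_succ n.le_succ).underlying.ConnectedComponent,
      ∃ μ : n.Partition,
        ((G.restrict n.le_succ n.le_succ).induce C.supp).IsIsomorphic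
          (standardDualEquivalenceGraph μ)) :
    ∃ Φ : V → List ℤ, (∀ v, IsStd (Φ v)) ∧ (∀ v, (Φ v).length = n + 1) ∧
      (∀ v (j : Set.Ico 1 (n + 1)), G.sign v j = sgn j (Φ v)) ∧
      ∀ (i : Set.Ioo 1 (n + 1)) v x, (G.E i).Adj v x → DualEquiv i (Φ v) (Φ x) := by
  obtain ⟨tl, H⟩ := exists_componentLabelling hstd
  obtain ⟨a, ha⟩ := H.exists_extension h1 h2 h3
  have L := H.isLabelling h1 h2 h4 h5 ha
  refine ⟨_, L.std, L.length, fun v => (ha v).2, ?_⟩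
  rintro ⟨i, hi, hin⟩ v x hvx
  rcases Nat.lt_or_ge i n with h | h
  · exact L.dual h ⟨⟨hi, hin⟩, hvx⟩
  · obtain rfl : i = n := by omega
    exact L.dualEquiv_of_adj hi ⟨⟨hi, hin⟩, hvx⟩

end SignedColoredGraph

/-! ### The main theorem -/

open SignedColoredGraph ContentVector in
theorem mainTheorem5 {V : Type*} [Finite V] (n : ℕ) (G : SignedColoredGraph (n + 1) (n + 1) V)
    (hconn : G.IsConnected)
    (h1 : G.Axiom1) (h2 : G.Axiom2) (h3 : G.Axiom3) (h4 : G.Axiom4) (h5 : G.Axiom5)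
    (hstd : ∀ C : (G.restrict n.le_succ n.le_succ).underlying.ConnectedComponent,
      ∃ μ : n.Partition,
        ((G.restrict n.le_succ n.le_succ).induce C.supp).IsIsomorphic
          (standardDualEquivalenceGraph μ)) :
    ∃ lam : (n + 1).Partition,
      (∃ φ : V → StandardTableau lam,
        G.IsMorphism (standardDualEquivalenceGraph lam) φ ∧ Function.Surjective φ) ∧
      ∀ μ : (n + 1).Partition,
        (∃ φ : V → StandardTableau μ, G.IsMorphism (standardDualEquivalenceGraph μ) φ) →
          μ = lam := by
  obtain ⟨Φ, hs, hlen, hsign, hadj⟩ := exists_labelling h1 h2 h3 h4 h5 hstd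
  obtain ⟨v₀⟩ : Nonempty V := hconn.nonempty
  obtain ⟨lam, hlam⟩ := exists_diagram (hs v₀) (hlen v₀)
  have hcells : ∀ v, cells (Φ v) = cells (Φ v₀) := by
    intro v
    obtain ⟨w⟩ := hconn.preconnected v v₀
    induction w with
    | nil => rfl
    | cons h _ ih =>
      obtain ⟨i, hi⟩ := SimpleGraph.iSup_adj.1 h
      exact (cells_eq_of_perm (hadj i _ _ hi).perm).trans (ih hlam)
  have hlift : ∀ {i v m}, DualEquiv i (Φ v) m →
      ∃ (hi : i ∈ Set.Ioo 1 (n + 1)) (u : V), (G.E ⟨i, hi⟩).Adj v u ∧ Φ u = m := by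
    intro i v m hm
    have hi := hm.two_le_lt
    rw [hlen] at hi
    obtain ⟨u, hi', hu⟩ := (exists_adjColor_iff h1 (hs v) (fun j _ => hsign v j) hi.1
      (by rw [hlen]; exact hi.2) (by omega)).2 ⟨m, hm⟩
    exact ⟨hi', u, hu, (hadj _ _ _ hu).unique hm⟩
  choose φ hφ using fun v => StandardTableau.exists_contents_eq (p := lam) (hs v) (hlen v)
    fun c => by rw [hcells v, hlam]
  refine ⟨lam, ⟨φ, ⟨fun v i => ?_, fun i u v huv => ?_⟩, fun T => ?_⟩, ?_⟩
  · rw [hsign, ← hφ]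
    exact ((φ v).descentSignature_eq i).symm
  · rw [standardDualEquivalenceGraph_adj_iff, hφ, hφ]
    exact hadj i u v huv
  · have hsh : shape (Φ v₀) = shape T.contents := by
      refine shape_eq_of_cells_eq (hs v₀) T.isStd_contents ?_
      ext c
      rw [T.mem_cells_contents, hlam]
    have hpath := reflTransGen_linked (hs v₀) T.isStd_contents (by simp [hlen]) hsh
    -- Paths of dual equivalences lift to `G`, so every tableau of the common shape is the label of
    -- a vertex.
    have key : ∀ l, Relation.ReflTransGen Linked (Φ v₀) l → ∃ u, Φ u = l := by
      intro l hl
      induction hl with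
      | refl => exact ⟨v₀, rfl⟩
      | tail _ hm ih =>
        obtain ⟨u, rfl⟩ := ih
        obtain ⟨i, hi⟩ := hm
        obtain ⟨-, w, -, hw⟩ := hlift hi
        exact ⟨w, hw⟩
    obtain ⟨u, hu⟩ := key _ hpath
    exact ⟨u, StandardTableau.contents_injective ((hφ u).trans hu)⟩
  · rintro μ ⟨ψ, hψ, hψ'⟩
    have heq : Φ v₀ = (ψ v₀).contents := by
      -- Two labels of the same vertex have the same signature. A dual equivalence of the first
      -- label lifts to an edge of `G`, and `ψ` maps that edge to a dual equivalence of the second.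
      refine eq_of_bisimulation (n + 1) (fun l l' => ∃ v, Φ v = l ∧ (ψ v).contents = l')
        ?_ ?_ ⟨v₀, rfl, rfl⟩
      · rintro l l' ⟨v, rfl, rfl⟩
        refine ⟨hs v, (ψ v).isStd_contents, hlen v, by simp, fun j hj hjn => ?_⟩
        have h := hψ v ⟨j, hj, hjn⟩
        rw [hsign] at h
        exact h.trans ((ψ v).descentSignature_eq _)
      · rintro i l l' m ⟨v, rfl, rfl⟩ hm
        obtain ⟨hi, u, hu, rfl⟩ := hlift hm
        exact ⟨_, standardDualEquivalenceGraph_adj_iff.1 (hψ' _ _ _ hu), u, rfl, rfl⟩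
    refine Nat.Partition.diagram_injective (YoungDiagram.ext ?_)
    ext c
    rw [YoungDiagram.mem_cells, YoungDiagram.mem_cells, hlam, heq, (ψ v₀).mem_cells_contents]
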